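/- Let $\mathbb D$ be the open unit disc in $\mathbb C$, $\overline{\mathbb D}$ its closure, and $\mathbb C_+=\{s\in\mathbb C:\operatorname{Re}s>0\}$. Consider the following three spaces of complex-valued functions, each with pointwise operations and the supremum norm. * $A(\overline{\mathbb D}^{\mathbb N})$: the functions $f:\overline{\mathbb D}^{\mathbb N}\to\mathbb C$ that are continuous for the product topology and separately holomorphic on $\mathbb D^{\mathbb N}$ (holomorphic on $\mathbb D$ in each coordinate when all other coordinates are fixed in $\mathbb D$). * $\mathcal A(\mathbb C_+)$: the uniformly continuous functions $f:\mathbb C_+\to\mathbb C$ for which there are $a_1,a_2,\ldots\in\mathbb C$ such that the Dirichlet series $\sum_{n=1}^\infty a_n n^{-s}$ converges to $f(s)$ for every $s\in\mathbb C_+$. * $\mathcal A_u(B_{c_0})$: the uniformly continuous, complex Fréchet differentiable functions $f:B_{c_0}\to\mathbb C$, where $B_{c_0}$ is the open unit ball of the space $c_0$ of complex null sequences with the supremum norm. All functions in these spaces are bounded, and each of the three spaces is a (unital) Banach algebra. The Banach algebra $A(\overline{\mathbb D}^{\mathbb N})$ is isometrically isomorphic, as a Banach algebra, to $\mathcal A(\mathbb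 C_+)$ and also to $\mathcal A_u(B_{c_0})$. -/

import Mathlib

open Set Filter Topology Metric
open scoped BoundedContinuousFunction ZeroAtInfty

/-- The closed polydisc `D̄^ℕ`, with the product topology. -/
abbrev ClosedPolydisc : Type := ℕ → closedBall (0 : ℂ) 1

/-- `f` is separately holomorphic on the open polydisc `D^ℕ`: if all coordinates but the `i`-th
are fixed in the open disc, then `f` is holomorphic in the `i`-th coordinate on the open disc. -/
def SeparatelyHolomorphic (f : ClosedPolydisc → ℂ) : Prop :=
  ∀ z : ClosedPolydisc, (∀ j, (z j : ℂ) ∈ ball (0 : ℂ) 1) → ∀ i : ℕ,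
    ∃ h : ℂ → ℂ, DifferentiableOn ℂ h (ball (0 : ℂ) 1) ∧
      ∀ w : closedBall (0 : ℂ) 1, (w : ℂ) ∈ ball (0 : ℂ) 1 → f (Function.update z i w) = h w

/-- The algebra `A(D̄^ℕ)` of continuous functions on `D̄^ℕ` that are separately holomorphic on
`D^ℕ`. It carries the supremum norm of `C(D̄^ℕ, ℂ)`. -/
def polydiscAlgebra : Subalgebra ℂ C(ClosedPolydisc, ℂ) where
  carrier := {f | SeparatelyHolomorphic f}
  mul_mem' := by
    intro f g hf hg z hz i
    obtain ⟨h, hd, he⟩ := hf z hz i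
    obtain ⟨k, kd, ke⟩ := hg z hz i
    exact ⟨h * k, hd.mul kd, fun w hw => by simp [he w hw, ke w hw]⟩
  add_mem' := by
    intro f g hf hg z hz i
    obtain ⟨h, hd, he⟩ := hf z hz i
    obtain ⟨k, kd, ke⟩ := hg z hz i
    exact ⟨h + k, hd.add kd, fun w hw => by simp [he w hw, ke w hw]⟩
  algebraMap_mem' := by
    intro c z _ i
    exact ⟨fun _ => c, differentiableOn_const c, fun w _ => by simp⟩

/-- The open right half-plane `ℂ₊`. -/
def rightHalfPlane : Set ℂ := {s | 0 < s.re}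

/-- The set `A(ℂ₊)` of all uniformly continuous functions on `ℂ₊` that are the pointwise sum of
a Dirichlet series `∑ aₙ / n ^ s` convergent (perhaps only conditionally) on `ℂ₊`. -/
def dirichletFunctions : Set (rightHalfPlane → ℂ) :=
  {f | UniformContinuous f ∧ ∃ a : ℕ → ℂ, ∀ s : rightHalfPlane,
    Tendsto (fun N : ℕ => ∑ n ∈ Finset.Icc 1 N, a n / (n : ℂ) ^ (s : ℂ)) atTop (𝓝 (f s))}

/-- The open unit ball of `c₀`. As `ℕ` is discrete, `C₀(ℕ, ℂ)` is the space of complex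
sequences that converge to zero, with the supremum norm. -/
def unitBallC0 : Set C₀(ℕ, ℂ) := ball 0 1

/-- The set `A_u(B_{c₀})` of all uniformly continuous, complex Fréchet differentiable functions
on the open unit ball of `c₀`. -/
def ballFunctions : Set (unitBallC0 → ℂ) :=
  {f | UniformContinuous f ∧ ∃ F : C₀(ℕ, ℂ) → ℂ,
    DifferentiableOn ℂ F unitBallC0 ∧ ∀ x : unitBallC0, f x = F x}

/-! Both isomorphisms are restrictions: a function on `D̄^ℕ` is composed with Bohr's substitution
`s ↦ (pᵢ⁻ˢ)ᵢ`, respectively with the inclusion of the ball of `c₀`, which has dense range. By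
Cauchy's formula in one coordinate after another, the polynomials are dense in `A(D̄^ℕ)`. Hence
Bohr's substitution needs to be seen isometric on polynomials only; there a coefficient is bounded
by the supremum over the half-plane (a vertical mean), and passing to powers of the polynomial
removes the number of coefficients from the resulting estimate.

An isometric restriction has closed range, so for surjectivity a uniformly continuous function
only has to be approximated. A function in `A(ℂ₊)` is averaged along vertical lines, which makes
its Dirichlet series absolutely summable. A function on the ball of `c₀` is dilated and expanded
into homogeneous polynomials. A homogeneous polynomial extends continuously to `D̄^ℕ` by induction
on the degree: otherwise its derivatives along a disjoint sequence of blocks would stay away from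
zero, and a Baire category argument as in Schur's theorem on `ℓ¹` excludes this. -/

section ClosedConditions

open MeasureTheory

theorem isClosed_setOf_differentiableOn {α : Type*} [TopologicalSpace α] {F : α → ℂ → ℂ}
    {U : Set ℂ} (hU : IsOpen U) (hF : ∀ a, TendstoLocallyUniformlyOn F (F a) (𝓝 a) U) :
    IsClosed {a | DifferentiableOn ℂ (F a) U} := by
  refine isClosed_iff_clusterPt.2 fun a ha => ?_
  have : (𝓝 a ⊓ 𝓟 {a | DifferentiableOn ℂ (F a) U}).NeBot := ha
  have hlim : TendstoLocallyUniformlyOn F (F a) (𝓝 a ⊓ 𝓟 {a | DifferentiableOn ℂ (F a) U}) U :=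
    fun u hu x hx => (hF a u hu x hx).imp fun _ h => ⟨h.1, h.2.filter_mono inf_le_left⟩
  exact hlim.differentiableOn (eventually_inf_principal.2 (Eventually.of_forall fun _ h => h)) hU

theorem tendstoUniformly_pi_iff {ι κ α : Type*} {β : κ → Type*} [∀ i, UniformSpace (β i)]
    {l : Filter ι} {F : ι → α → ∀ i, β i} {f : α → ∀ i, β i} :
    TendstoUniformly F f l ↔ ∀ i, TendstoUniformly (fun k x => F k x i) (fun x => f x i) l := by
  simp only [tendstoUniformly_iff_tendsto, Pi.uniformity, tendsto_iInf, tendsto_comap_iff,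
    Function.comp_def]

theorem circleAverage_mem_of_convex {E : Type*} [NormedAddCommGroup E] [NormedSpace ℝ E]
    [CompleteSpace E] {s : Set E} (hs : Convex ℝ s) (hsc : IsClosed s) {f : ℂ → E} {c : ℂ} {R : ℝ}
    (hfi : CircleIntegrable f c R) (hf : ∀ z ∈ sphere c |R|, f z ∈ s) :
    Real.circleAverage f c R ∈ s := by
  rw [Real.circleAverage_eq_intervalAverage]
  refine hs.set_average_mem hsc ?_ ?_ (ae_of_all _ fun θ => hf _ (circleMap_mem_sphere' c R θ)) ?_
  · simp [uIoc, Real.pi_pos]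
  · simp [uIoc]
  · exact intervalIntegrable_iff.1 hfi

theorem ringInverse_one_sub_mem {𝕜 A : Type*} [NormedField 𝕜] [NormedRing A] [NormedAlgebra 𝕜 A]
    [HasSummableGeomSeries A] {S : Subalgebra 𝕜 A} (hS : IsClosed (S : Set A)) {a : A} (ha : a ∈ S)
    (h : ‖a‖ < 1) : Ring.inverse (1 - a) ∈ S := by
  rw [← geom_series_eq_inverse a h]
  exact hS.mem_of_tendsto (summable_geometric_of_norm_lt_one h).hasSum
    (Eventually.of_forall fun s => S.sum_mem fun k _ => S.pow_mem ha k)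

end ClosedConditions

section PolydiscAlgebra

/-- The radial retraction of the plane onto the closed unit disc. With it a function on the
closed disc becomes a function on the plane, the form in which derivatives and circle averages
are taken. -/
noncomputable def toDisc : C(ℂ, closedBall (0 : ℂ) 1) where
  toFun w := ⟨(max 1 ‖w‖)⁻¹ * w, by
    have h : 0 < max 1 ‖w‖ := lt_max_of_lt_left one_pos
    simpa [abs_of_pos h] using (inv_mul_le_one₀ h).2 (le_max_right 1 ‖w‖)⟩
  continuous_toFun := by
    refine Continuous.subtype_mk (Continuous.mul ?_ continuous_id) _
    exact Complex.continuous_ofReal.comp ((continuous_const.max continuous_norm).inv₀ fun w =>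
      (lt_max_of_lt_left one_pos).ne')

theorem toDisc_eq {w : ℂ} (hw : w ∈ closedBall (0 : ℂ) 1) : toDisc w = ⟨w, hw⟩ := by
  ext
  simp [toDisc, max_eq_left (mem_closedBall_zero_iff.1 hw)]

@[simp] theorem toDisc_coe (w : closedBall (0 : ℂ) 1) : toDisc w = w := toDisc_eq w.2

/-- The family of functions obtained from `g` by fixing the `n`-th coordinate, as a continuous
curve with values in `C(D̄^ℕ, ℂ)`. -/
noncomputable def fixCoord (g : C(ClosedPolydisc, ℂ)) (n : ℕ) : C(ℂ, C(ClosedPolydisc, ℂ)) :=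
  ContinuousMap.curry ⟨fun p => g (Function.update p.2 n (toDisc p.1)), by fun_prop⟩

theorem fixCoord_apply (g : C(ClosedPolydisc, ℂ)) (n : ℕ) (w : ℂ) (z : ClosedPolydisc) :
    fixCoord g n w z = g (Function.update z n (toDisc w)) := rfl

theorem fixCoord_self (g : C(ClosedPolydisc, ℂ)) (n : ℕ) (z : ClosedPolydisc) :
    fixCoord g n (z n) z = g z := by
  rw [fixCoord_apply, toDisc_coe, Function.update_eq_self]

theorem separatelyHolomorphic_iff_fixCoord {g : C(ClosedPolydisc, ℂ)} :
    SeparatelyHolomorphic g ↔ ∀ z : ClosedPolydisc, (∀ j, (z j : ℂ) ∈ ball (0 : ℂ) 1) → ∀ i : ℕ,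
      DifferentiableOn ℂ (fun w => fixCoord g i w z) (ball 0 1) := by
  refine forall₃_congr fun z _ i => ⟨fun ⟨h, hd, he⟩ => hd.congr fun w hw => ?_, fun hd => ?_⟩
  · rw [fixCoord_apply, toDisc_eq (ball_subset_closedBall hw), he _ hw]
  · exact ⟨_, hd, fun w _ => by rw [fixCoord_apply, toDisc_coe]⟩

theorem dense_openPolydisc : Dense {z : ClosedPolydisc | ∀ j, (z j : ℂ) ∈ ball (0 : ℂ) 1} := by
  have hdisc : Dense {w : closedBall (0 : ℂ) 1 | (w : ℂ) ∈ ball (0 : ℂ) 1} := by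
    have : ((↑) '' {w : closedBall (0 : ℂ) 1 | (w : ℂ) ∈ ball (0 : ℂ) 1} : Set ℂ) = ball 0 1 :=
      (Subtype.image_preimage_coe _ _).trans (inter_eq_right.2 ball_subset_closedBall)
    rw [Subtype.dense_iff, this, closure_ball _ one_ne_zero]
  simpa [Set.pi] using dense_pi univ fun (_ : ℕ) _ => hdisc

theorem tendstoUniformly_fixCoord (g : C(ClosedPolydisc, ℂ)) (n : ℕ) (z : ClosedPolydisc) :
    TendstoUniformly (fun y w => fixCoord g n w y) (fun w => fixCoord g n w z) (𝓝 z) := by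
  let G : C(ClosedPolydisc, C(closedBall (0 : ℂ) 1, ℂ)) :=
    ContinuousMap.curry ⟨fun p => g (Function.update p.1 n p.2), by fun_prop⟩
  exact (ContinuousMap.tendsto_iff_tendstoUniformly.1 (G.continuous.tendsto z)).comp toDisc

/-- Holomorphy in each coordinate persists when the other coordinates are fixed in the closed
disc, because the one-variable functions in question depend continuously on these coordinates. -/
theorem mem_polydiscAlgebra_iff {g : C(ClosedPolydisc, ℂ)} :
    g ∈ polydiscAlgebra ↔ ∀ (z : ClosedPolydisc) (i : ℕ),
      DifferentiableOn ℂ (fun w => fixCoord g i w z) (ball 0 1) := by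
  refine ⟨fun hg z i => ?_, fun hg => separatelyHolomorphic_iff_fixCoord.2 fun z _ i => hg z i⟩
  have hclosed := isClosed_setOf_differentiableOn isOpen_ball fun y =>
    (tendstoUniformly_fixCoord g i y).tendstoUniformlyOn.tendstoLocallyUniformlyOn
      (s := ball (0 : ℂ) 1)
  exact hclosed.closure_subset_iff.2
    (fun y hy => separatelyHolomorphic_iff_fixCoord.1 hg y hy i) (dense_openPolydisc z)

theorem isClosed_polydiscAlgebra : IsClosed (polydiscAlgebra : Set C(ClosedPolydisc, ℂ)) := by
  have : (polydiscAlgebra : Set C(ClosedPolydisc, ℂ)) = ⋂ (z : ClosedPolydisc) (i : ℕ),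
      {g | DifferentiableOn ℂ (fun w => fixCoord g i w z) (ball 0 1)} := by
    ext g
    simpa using mem_polydiscAlgebra_iff
  rw [this]
  refine isClosed_iInter fun z => isClosed_iInter fun i =>
    isClosed_setOf_differentiableOn isOpen_ball fun g => ?_
  exact ((ContinuousMap.tendsto_iff_tendstoUniformly.1 tendsto_id).comp
    fun w => Function.update z i (toDisc w)).tendstoUniformlyOn.tendstoLocallyUniformlyOn

instance : CompleteSpace polydiscAlgebra := isClosed_polydiscAlgebra.completeSpace_coe

/-- The `i`-th coordinate function on the closed polydisc. -/
def coord (i : ℕ) : C(ClosedPolydisc, ℂ) := ⟨fun z => z i, by fun_prop⟩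

@[simp] theorem coord_apply (i : ℕ) (z : ClosedPolydisc) : coord i z = z i := rfl

theorem norm_coord_le (i : ℕ) : ‖coord i‖ ≤ 1 :=
  (ContinuousMap.norm_le _ zero_le_one).2 fun z => mem_closedBall_zero_iff.1 (z i).2

theorem coord_mem_polydiscAlgebra (i : ℕ) : coord i ∈ polydiscAlgebra := by
  intro z _ j
  by_cases h : i = j
  · subst h
    exact ⟨id, differentiableOn_id, fun w _ => by simp⟩
  · exact ⟨fun _ => z i, differentiableOn_const _, fun w _ => by simp [h]⟩

/-- The closure in `C(D̄^ℕ, ℂ)` of the polynomials in finitely many coordinates. -/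
noncomputable def coordClosure : Subalgebra ℂ C(ClosedPolydisc, ℂ) :=
  (Algebra.adjoin ℂ (range coord)).topologicalClosure

theorem isClosed_coordClosure : IsClosed (coordClosure : Set C(ClosedPolydisc, ℂ)) :=
  Subalgebra.isClosed_topologicalClosure _

theorem coord_mem_coordClosure (i : ℕ) : coord i ∈ coordClosure :=
  Subalgebra.le_topologicalClosure _ (Algebra.subset_adjoin (mem_range_self i))

/-- Precomposition of `g` with the multiplication of the `n`-th coordinate by `r`, for
`|r| ≤ 1`. -/
noncomputable def dilateCoord (g : C(ClosedPolydisc, ℂ)) (n : ℕ) : C(ℝ, C(ClosedPolydisc, ℂ)) :=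
  ContinuousMap.curry ⟨fun p => fixCoord g n (p.1 * p.2 n) p.2, by
    unfold fixCoord; simp only [ContinuousMap.curry_apply, ContinuousMap.coe_mk]; fun_prop⟩

theorem dilateCoord_apply (g : C(ClosedPolydisc, ℂ)) (n : ℕ) (r : ℝ) (z : ClosedPolydisc) :
    dilateCoord g n r z = fixCoord g n (r * z n) z := rfl

theorem dilateCoord_one (g : C(ClosedPolydisc, ℂ)) (n : ℕ) : dilateCoord g n 1 = g := by
  ext z
  rw [dilateCoord_apply, Complex.ofReal_one, one_mul, fixCoord_self]

/-- The integrand in Cauchy's formula for `z ↦ g (…, r * z n, …)` as a function with values in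
`C(D̄^ℕ, ℂ)`. On the unit circle `(1 - conj ζ * r * z n)⁻¹` is the Cauchy kernel
`ζ / (ζ - r * z n)`. -/
noncomputable def cauchyIntegrand (g : C(ClosedPolydisc, ℂ)) (n : ℕ) (r : ℝ) (ζ : ℂ) :
    C(ClosedPolydisc, ℂ) :=
  Ring.inverse (1 - (starRingEnd ℂ ζ * r) • coord n) * fixCoord g n ζ

section Cauchy

variable {g : C(ClosedPolydisc, ℂ)} {n : ℕ} {r : ℝ} {ζ : ℂ}

theorem norm_conj_mul_smul_coord_lt (hr0 : 0 ≤ r) (hr1 : r < 1) (hζ : ζ ∈ sphere (0 : ℂ) 1) :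
    ‖(starRingEnd ℂ ζ * r) • coord n‖ < 1 := by
  calc ‖(starRingEnd ℂ ζ * r) • coord n‖ = r * ‖coord n‖ := by
        simp [norm_smul, mem_sphere_zero_iff_norm.1 hζ, abs_of_nonneg hr0]
    _ ≤ r := mul_le_of_le_one_right hr0 (norm_coord_le n)
    _ < 1 := hr1

theorem cauchyIntegrand_apply (hr0 : 0 ≤ r) (hr1 : r < 1) (hζ : ζ ∈ sphere (0 : ℂ) 1)
    (z : ClosedPolydisc) :
    cauchyIntegrand g n r ζ z = ((ζ - 0) / (ζ - r * z n)) • fixCoord g n ζ z := by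
  have hζζ : starRingEnd ℂ ζ * ζ = 1 := by
    rw [mul_comm, Complex.mul_conj, Complex.normSq_eq_norm_sq, mem_sphere_zero_iff_norm.1 hζ]
    simp
  have hunit := Ring.inverse_mul_cancel _
    (isUnit_one_sub_of_norm_lt_one (norm_conj_mul_smul_coord_lt (n := n) hr0 hr1 hζ))
  replace hunit := eq_inv_of_mul_eq_one_left (DFunLike.congr_fun hunit z)
  have hζ0 : ζ ≠ 0 := ne_of_mem_sphere hζ one_ne_zero
  have hkernel : (1 : ℂ) - starRingEnd ℂ ζ * r * z n = (ζ - r * z n) / ζ := by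
    rw [eq_div_iff hζ0]
    linear_combination (-(r : ℂ) * z n) * hζζ
  rw [cauchyIntegrand, ContinuousMap.mul_apply, hunit, sub_zero, smul_eq_mul]
  simp only [ContinuousMap.sub_apply, ContinuousMap.one_apply, ContinuousMap.smul_apply,
    coord_apply, smul_eq_mul, hkernel, inv_div]

theorem circleIntegrable_cauchyIntegrand (hr0 : 0 ≤ r) (hr1 : r < 1) :
    CircleIntegrable (cauchyIntegrand g n r) 0 1 := by
  refine ContinuousOn.circleIntegrable zero_le_one (ContinuousOn.mul (fun ζ hζ => ?_)
    (fixCoord g n).continuous.continuousOn)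
  obtain ⟨u, hu⟩ :=
    isUnit_one_sub_of_norm_lt_one (norm_conj_mul_smul_coord_lt (n := n) hr0 hr1 hζ)
  have hinv : ContinuousAt Ring.inverse (1 - (starRingEnd ℂ ζ * r) • coord n) :=
    hu ▸ NormedRing.inverse_continuousAt u
  refine (ContinuousAt.comp (g := Ring.inverse)
    (f := fun ζ => 1 - (starRingEnd ℂ ζ * r) • coord n) hinv ?_).continuousWithinAt
  exact continuousAt_const.sub
    (((Complex.continuous_conj.mul continuous_const).smul continuous_const).continuousAt)

theorem circleAverage_cauchyIntegrand (hg : g ∈ polydiscAlgebra) (hr0 : 0 ≤ r) (hr1 : r < 1) :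
    Real.circleAverage (cauchyIntegrand g n r) 0 1 = dilateCoord g n r := by
  ext z
  have hz : (r * z n : ℂ) ∈ ball (0 : ℂ) |1| := by
    rw [abs_one, mem_ball_zero_iff, norm_mul, Complex.norm_real, Real.norm_of_nonneg hr0]
    exact (mul_le_of_le_one_right hr0 (mem_closedBall_zero_iff.1 (z n).2)).trans_lt hr1
  have hholo : DiffContOnCl ℂ (fun w => fixCoord g n w z) (ball 0 |1|) := by
    rw [abs_one]
    exact ⟨mem_polydiscAlgebra_iff.1 hg z n, by fun_prop⟩
  let eval : C(ClosedPolydisc, ℂ) →L[ℝ] ℂ := (ContinuousMap.evalCLM ℂ z).restrictScalars ℝ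
  calc eval (Real.circleAverage (cauchyIntegrand g n r) 0 1)
      = Real.circleAverage (fun ζ => cauchyIntegrand g n r ζ z) 0 1 :=
        (eval.circleAverage_comp_comm (circleIntegrable_cauchyIntegrand hr0 hr1)).symm
    _ = Real.circleAverage (fun ζ => ((ζ - 0) / (ζ - r * z n)) • fixCoord g n ζ z) 0 1 :=
        Real.circleAverage_congr_sphere fun ζ hζ =>
          cauchyIntegrand_apply hr0 hr1 (abs_one (α := ℝ) ▸ hζ) z
    _ = dilateCoord g n r z := hholo.circleAverage_smul_div hz

end Cauchy

theorem fixCoord_mem_polydiscAlgebra {g : C(ClosedPolydisc, ℂ)} (hg : g ∈ polydiscAlgebra) (n : ℕ)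
    (w : ℂ) : fixCoord g n w ∈ polydiscAlgebra := by
  refine mem_polydiscAlgebra_iff.2 fun z i => ?_
  by_cases h : i = n
  · subst h
    simp only [fixCoord_apply, Function.update_idem]
    exact differentiableOn_const _
  · simp only [fixCoord_apply, Function.update_comm h]
    exact mem_polydiscAlgebra_iff.1 hg _ i

theorem dependsOn_fixCoord {g : C(ClosedPolydisc, ℂ)} {n : ℕ} (hg : DependsOn g (Iio (n + 1)))
    (w : ℂ) : DependsOn (fixCoord g n w) (Iio n) := by
  refine fun x y hxy => hg fun i hi => ?_
  by_cases h : i = n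
  · subst h; simp
  · simpa [h] using hxy i (lt_of_le_of_ne (Nat.lt_succ_iff.1 hi) h)

theorem mem_coordClosure_of_dependsOn {n : ℕ} {g : C(ClosedPolydisc, ℂ)}
    (hg : g ∈ polydiscAlgebra) (hd : DependsOn g (Iio n)) : g ∈ coordClosure := by
  induction n generalizing g with
  | zero =>
    have hconst : g = algebraMap ℂ _ (g 0) := ContinuousMap.ext fun z =>
      hd fun i hi => absurd hi (Nat.not_lt_zero i)
    exact hconst ▸ coordClosure.algebraMap_mem _
  | succ n ih =>
    have hdil : ∀ r ∈ Ico (0 : ℝ) 1, dilateCoord g n r ∈ coordClosure := fun r hr => by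
      rw [← circleAverage_cauchyIntegrand hg hr.1 hr.2]
      have hconvex : Convex ℝ (coordClosure : Set C(ClosedPolydisc, ℂ)) :=
        (coordClosure.toSubmodule.restrictScalars ℝ).convex
      refine circleAverage_mem_of_convex hconvex isClosed_coordClosure
        (circleIntegrable_cauchyIntegrand hr.1 hr.2) fun ζ hζ => coordClosure.mul_mem ?_ ?_
      · exact ringInverse_one_sub_mem isClosed_coordClosure
          (coordClosure.smul_mem (coord_mem_coordClosure n) _)
          (norm_conj_mul_smul_coord_lt hr.1 hr.2 (abs_one (α := ℝ) ▸ hζ))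
      · exact ih (fixCoord_mem_polydiscAlgebra hg n ζ) (dependsOn_fixCoord hd ζ)
    have hlim : Tendsto (dilateCoord g n) (𝓝[<] 1) (𝓝 g) := by
      simpa only [dilateCoord_one] using
        ((dilateCoord g n).continuous.tendsto 1).mono_left nhdsWithin_le_nhds
    exact isClosed_coordClosure.mem_of_tendsto hlim
      (eventually_of_mem (Ico_mem_nhdsLT one_pos) hdil)

/-- The map that replaces all coordinates from the `n`-th on by `0`. -/
noncomputable def truncate (n : ℕ) : C(ClosedPolydisc, ClosedPolydisc) where
  toFun z i := if i < n then z i else 0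
  continuous_toFun := continuous_pi fun i => by split_ifs <;> fun_prop

theorem truncate_apply (n : ℕ) (z : ClosedPolydisc) (i : ℕ) :
    truncate n z i = if i < n then z i else 0 := rfl

theorem truncate_update (n i : ℕ) (z : ClosedPolydisc) (w : closedBall (0 : ℂ) 1) :
    truncate n (Function.update z i w) =
      if i < n then Function.update (truncate n z) i w else truncate n z := by
  ext j
  rcases eq_or_ne j i with rfl | hj
  · split_ifs with h <;> simp [truncate_apply, h]
  · split_ifs <;> simp [truncate_apply, hj]

theorem comp_truncate_mem_polydiscAlgebra {g : C(ClosedPolydisc, ℂ)} (hg : g ∈ polydiscAlgebra)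
    (n : ℕ) : g.comp (truncate n) ∈ polydiscAlgebra := by
  refine mem_polydiscAlgebra_iff.2 fun z i => ?_
  simp only [fixCoord_apply, ContinuousMap.comp_apply, truncate_update]
  split_ifs
  · exact mem_polydiscAlgebra_iff.1 hg (truncate n z) i
  · exact differentiableOn_const _

theorem tendstoUniformly_truncate : TendstoUniformly (fun n z => truncate n z) id atTop := by
  refine tendstoUniformly_pi_iff.2 fun i u hu => ?_
  filter_upwards [eventually_gt_atTop i] with n hn z
  simpa [truncate_apply, hn] using refl_mem_uniformity hu

theorem tendsto_comp_truncate (g : C(ClosedPolydisc, ℂ)) :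
    Tendsto (fun n => g.comp (truncate n)) atTop (𝓝 g) := by
  rw [ContinuousMap.tendsto_iff_tendstoUniformly]
  exact (CompactSpace.uniformContinuous_of_continuous g.continuous).comp_tendstoUniformly
    tendstoUniformly_truncate

theorem polydiscAlgebra_le_coordClosure : polydiscAlgebra ≤ coordClosure := fun g hg => by
  refine isClosed_coordClosure.mem_of_tendsto (tendsto_comp_truncate g) (Eventually.of_forall
    fun n => mem_coordClosure_of_dependsOn (n := n) (comp_truncate_mem_polydiscAlgebra hg n) ?_)
  intro x y hxy
  refine congrArg g (funext fun i => ?_)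
  simp only [truncate_apply]
  split_ifs with hi
  exacts [hxy i hi, rfl]

end PolydiscAlgebra

section Pullback

variable {X K : Type*} [TopologicalSpace X] [TopologicalSpace K] [CompactSpace K]

/-- Composition with a continuous map `τ : X → K`, as a homomorphism from the continuous functions
on the compact space `K` to the bounded continuous functions on `X`. -/
noncomputable def pullback (τ : C(X, K)) : C(K, ℂ) →ₐ[ℂ] (X →ᵇ ℂ) where
  toFun g := (BoundedContinuousFunction.mkOfCompact g).compContinuous τ
  map_one' := rfl
  map_mul' _ _ := rfl
  map_zero' := rfl
  map_add' _ _ := rfl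
  commutes' _ := rfl

@[simp] theorem pullback_apply (τ : C(X, K)) (g : C(K, ℂ)) (x : X) : pullback τ g x = g (τ x) := rfl

theorem norm_pullback_le (τ : C(X, K)) (g : C(K, ℂ)) : ‖pullback τ g‖ ≤ ‖g‖ :=
  (BoundedContinuousFunction.norm_le (norm_nonneg _)).2 fun _ => g.norm_coe_le_norm _

theorem continuous_pullback (τ : C(X, K)) : Continuous (pullback τ) :=
  AddMonoidHomClass.continuous_of_bound (pullback τ) 1 fun g => by
    simpa only [one_mul] using norm_pullback_le τ g

variable {B : Subalgebra ℂ C(K, ℂ)} {τ : C(X, K)}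

theorem isometry_pullback_comp_val (h : ∀ g ∈ B, ‖g‖ ≤ ‖pullback τ g‖) :
    Isometry ((pullback τ).comp B.val) :=
  AddMonoidHomClass.isometry_of_norm _ fun g => le_antisymm (norm_pullback_le τ _) (h g g.2)

theorem isClosed_range_pullback_comp_val [CompleteSpace B] (h : ∀ g ∈ B, ‖g‖ ≤ ‖pullback τ g‖) :
    IsClosed (((pullback τ).comp B.val).range : Set (X →ᵇ ℂ)) := by
  rw [AlgHom.coe_range]
  exact (isometry_pullback_comp_val h).isClosedEmbedding.isClosed_range

theorem exists_algEquiv_of_norm_le_norm_pullback [CompleteSpace B]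
    (h : ∀ g ∈ B, ‖g‖ ≤ ‖pullback τ g‖) {S : Set (X → ℂ)} (hBS : ∀ g ∈ B, g ∘ τ ∈ S)
    (hSB : ∀ f ∈ S, ∃ g ∈ B, g ∘ τ = f) :
    ∃ A : Subalgebra ℂ (X →ᵇ ℂ),
      (fun f : X →ᵇ ℂ => (f : X → ℂ)) '' (A : Set (X →ᵇ ℂ)) = S ∧
      CompleteSpace A ∧ ∃ e : B ≃ₐ[ℂ] A, Isometry e := by
  have hiso := isometry_pullback_comp_val h
  refine ⟨((pullback τ).comp B.val).range, Subset.antisymm ?_ fun f hf => ?_,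
    (isClosed_range_pullback_comp_val h).completeSpace_coe,
    AlgEquiv.ofInjective _ hiso.injective, fun x y => hiso x y⟩
  · rintro _ ⟨_, ⟨g, rfl⟩, rfl⟩
    exact hBS g g.2
  · obtain ⟨g, hg, he⟩ := hSB f hf
    exact ⟨_, ⟨⟨g, hg⟩, rfl⟩, he⟩

theorem exists_comp_eq_of_forall_approx [CompleteSpace B] (h : ∀ g ∈ B, ‖g‖ ≤ ‖pullback τ g‖)
    {f : X → ℂ} (hf : Continuous f) (happrox : ∀ ε > 0, ∃ g ∈ B, ∀ x, ‖g (τ x) - f x‖ ≤ ε) :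
    ∃ g ∈ B, g ∘ τ = f := by
  obtain ⟨g₁, -, h₁⟩ := happrox 1 one_pos
  have hbdd : ∀ x, ‖f x‖ ≤ ‖g₁‖ + 1 := fun x => by
    linarith [norm_le_norm_add_norm_sub (g₁ (τ x)) (f x), g₁.norm_coe_le_norm (τ x), h₁ x]
  let f' : X →ᵇ ℂ := BoundedContinuousFunction.ofNormedAddCommGroup f hf _ hbdd
  have hf' : f' ∈ closure (((pullback τ).comp B.val).range : Set (X →ᵇ ℂ)) := by
    refine Metric.mem_closure_iff.2 fun ε hε => ?_
    obtain ⟨g, hg, hgf⟩ := happrox (ε / 2) (half_pos hε)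
    refine ⟨pullback τ g, ⟨⟨g, hg⟩, rfl⟩, lt_of_le_of_lt ?_ (half_lt_self hε)⟩
    rw [dist_comm, BoundedContinuousFunction.dist_le (half_pos hε).le]
    exact fun x => (dist_eq_norm _ _).trans_le (hgf x)
  rw [(isClosed_range_pullback_comp_val h).closure_eq] at hf'
  obtain ⟨g, hg⟩ := hf'
  exact ⟨g, g.2, congrArg DFunLike.coe hg⟩

theorem norm_le_norm_pullback_of_denseRange (hτ : DenseRange τ) (g : C(K, ℂ)) :
    ‖g‖ ≤ ‖pullback τ g‖ :=
  (g.norm_le (norm_nonneg _)).2 fun z => hτ.induction_on z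
    (isClosed_le g.continuous.norm continuous_const) (pullback τ g).norm_coe_le_norm

theorem norm_le_norm_pullback_of_adjoin {τ : C(X, ClosedPolydisc)}
    (h : ∀ g ∈ Algebra.adjoin ℂ (range coord), ‖g‖ ≤ ‖pullback τ g‖) :
    ∀ g ∈ polydiscAlgebra, ‖g‖ ≤ ‖pullback τ g‖ := fun _ hg =>
  closure_minimal (s := (Algebra.adjoin ℂ (range coord) : Set C(ClosedPolydisc, ℂ))) h
    (isClosed_le continuous_norm (continuous_pullback τ).norm) (polydiscAlgebra_le_coordClosure hg)

end Pullback

section BohrCoefficients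

theorem norm_integral_exp_mul_I_le (ω T : ℝ) (hω : ω ≠ 0) :
    ‖∫ t in (0 : ℝ)..T, Complex.exp (ω * Complex.I * t)‖ ≤ 2 / |ω| := by
  have hexp : ∀ x : ℝ, ‖Complex.exp (ω * Complex.I * x)‖ = 1 := fun x => by
    rw [mul_right_comm, ← Complex.ofReal_mul, Complex.norm_exp_ofReal_mul_I]
  rw [integral_exp_mul_complex (mul_ne_zero (Complex.ofReal_ne_zero.2 hω) Complex.I_ne_zero),
    norm_div, norm_mul, Complex.norm_I, mul_one, Complex.norm_real, Real.norm_eq_abs]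
  gcongr
  exact (norm_sub_le _ _).trans (by rw [hexp, hexp, one_add_one_eq_two])

theorem tendsto_mean_exp_mul_I (ω : ℝ) :
    Tendsto (fun T : ℝ => (T : ℂ)⁻¹ * ∫ t in (0 : ℝ)..T, Complex.exp (ω * Complex.I * t)) atTop
      (𝓝 (if ω = 0 then 1 else 0)) := by
  split_ifs with h
  · refine tendsto_const_nhds.congr' ?_
    filter_upwards [eventually_ne_atTop 0] with T hT
    simp [h, hT]
  · have hlim : Tendsto (fun T : ℝ => T⁻¹ * (2 / |ω|)) atTop (𝓝 0) := by
      simpa using tendsto_inv_atTop_zero.mul_const (2 / |ω|)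
    refine squeeze_zero_norm' ?_ hlim
    filter_upwards [eventually_gt_atTop 0] with T hT
    rw [norm_mul, norm_inv, Complex.norm_real, Real.norm_of_nonneg hT.le]
    gcongr
    exact norm_integral_exp_mul_I_le ω T h

theorem norm_coeff_le_of_expSum {ι : Type*} {S : Finset ι} {c : ι → ℂ} {ω : ι → ℝ} {M : ℝ}
    (hω : InjOn ω S) (hM : ∀ t : ℝ, ‖∑ α ∈ S, c α * Complex.exp (ω α * Complex.I * t)‖ ≤ M)
    {β : ι} (hβ : β ∈ S) : ‖c β‖ ≤ M := by
  classical
  have hmean : ∀ T : ℝ, (T : ℂ)⁻¹ * ∫ t in (0 : ℝ)..T, (∑ α ∈ S,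
        c α * Complex.exp (ω α * Complex.I * t)) * Complex.exp ((-(ω β * t) : ℝ) * Complex.I) =
      ∑ α ∈ S, c α * ((T : ℂ)⁻¹ *
        ∫ t in (0 : ℝ)..T, Complex.exp ((ω α - ω β : ℝ) * Complex.I * t)) := fun T => by
    simp only [Finset.sum_mul, mul_assoc (c _), ← Complex.exp_add]
    rw [intervalIntegral.integral_finsetSum fun α _ =>
      Continuous.intervalIntegrable (by fun_prop) _ _, Finset.mul_sum]
    refine Finset.sum_congr rfl fun α _ => ?_
    rw [intervalIntegral.integral_const_mul, mul_left_comm]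
    congr! 5
    push_cast
    ring
  have hlim := tendsto_finsetSum S fun α _ =>
    (tendsto_mean_exp_mul_I (ω α - ω β)).const_mul (c α)
  have hsum : ∑ α ∈ S, c α * (if ω α - ω β = 0 then 1 else 0) = c β := by
    rw [Finset.sum_eq_single_of_mem β hβ fun α hα hne => ?_]
    · simp
    · simp [sub_eq_zero, hω.eq_iff hα hβ, hne]
  rw [hsum] at hlim
  refine le_of_tendsto hlim.norm ?_
  filter_upwards [eventually_gt_atTop 0] with T hT
  rw [← hmean, norm_mul, norm_inv, Complex.norm_real, Real.norm_of_nonneg hT.le, inv_mul_le_iff₀ hT]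
  refine (intervalIntegral.norm_integral_le_of_norm_le_const fun t _ => ?_).trans_eq
    (by rw [sub_zero, abs_of_pos hT, mul_comm])
  rw [norm_mul, Complex.norm_exp_ofReal_mul_I, mul_one]
  exact hM t

theorem norm_coeff_le_of_dirichletSum {ι : Type*} {S : Finset ι} {c : ι → ℂ} {n : ι → ℕ} {M : ℝ}
    (hn : InjOn n S) (hn0 : ∀ α ∈ S, n α ≠ 0)
    (hM : ∀ s : ℂ, 0 < s.re → ‖∑ α ∈ S, c α * (n α : ℂ) ^ (-s)‖ ≤ M)
    {β : ι} (hβ : β ∈ S) : ‖c β‖ ≤ M := by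
  have hline : ∀ σ : ℝ, 0 < σ → ‖c β * (n β : ℂ) ^ (-(σ : ℂ))‖ ≤ M := fun σ hσ => by
    refine norm_coeff_le_of_expSum (c := fun α => c α * (n α : ℂ) ^ (-(σ : ℂ)))
      (ω := fun α => -Real.log (n α)) (fun α hα γ hγ h => hn hα hγ ?_) (fun t => ?_) hβ
    · have hpos : ∀ δ ∈ S, (0 : ℝ) < n δ := fun δ hδ => Nat.cast_pos.2 (hn0 δ hδ).bot_lt
      exact_mod_cast Real.log_injOn_pos (hpos α hα) (hpos γ hγ) (neg_injective h)
    · refine le_of_eq_of_le ?_ (hM (σ + t * Complex.I) (by simpa using hσ))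
      refine congrArg _ (Finset.sum_congr rfl fun α hα => ?_)
      have h0 : (n α : ℂ) ≠ 0 := Nat.cast_ne_zero.2 (hn0 α hα)
      rw [mul_assoc, neg_add, Complex.cpow_add _ _ h0, Complex.cpow_def_of_ne_zero h0 (-(t * _)),
        ← Complex.natCast_log]
      congr 3
      push_cast
      ring
  have hβ0 : (n β : ℂ) ≠ 0 := Nat.cast_ne_zero.2 (hn0 β hβ)
  have hcont : Continuous fun σ : ℝ => ‖c β * (n β : ℂ) ^ (-(σ : ℂ))‖ :=
    (continuous_const.mul (Continuous.const_cpow (by fun_prop) (Or.inl hβ0))).norm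
  have hlim : Tendsto (fun σ : ℝ => ‖c β * (n β : ℂ) ^ (-(σ : ℂ))‖) (𝓝[>] 0) (𝓝 ‖c β‖) := by
    simpa using (hcont.tendsto 0).mono_left nhdsWithin_le_nhds
  exact le_of_tendsto hlim (eventually_mem_nhdsWithin.mono hline)

end BohrCoefficients

section BohrLift

/-- The increasing enumeration of the primes, indexed from `0`. -/
noncomputable def nthPrime : ℕ ↪ ℕ :=
  ⟨Nat.nth Nat.Prime, Nat.nth_injective Nat.infinite_setOfPred_prime⟩

theorem prime_nthPrime (i : ℕ) : (nthPrime i).Prime := Nat.prime_nth_prime i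

theorem range_nthPrime : range nthPrime = {p | p.Prime} :=
  Nat.range_nth_of_infinite Nat.infinite_setOfPred_prime

/-- The number `∏ pᵢ ^ αᵢ` attached to a multi-index `α`. -/
noncomputable def bohrIndex (α : ℕ →₀ ℕ) : ℕ := (α.embDomain nthPrime).prod (· ^ ·)

/-- The multi-index of the exponents in the prime factorization of `n`, which is inverse to
`bohrIndex` on the positive integers. -/
noncomputable def bohrExponent (n : ℕ) : ℕ →₀ ℕ :=
  n.factorization.comapDomain nthPrime nthPrime.injective.injOn

theorem factorization_bohrIndex (α : ℕ →₀ ℕ) :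
    (bohrIndex α).factorization = α.embDomain nthPrime := by
  refine Nat.prod_pow_factorization_eq_self fun p hp => ?_
  obtain ⟨i, -, rfl⟩ := Finset.mem_map.1 (Finsupp.support_embDomain nthPrime α ▸ hp)
  exact prime_nthPrime i

theorem bohrIndex_ne_zero (α : ℕ →₀ ℕ) : bohrIndex α ≠ 0 := by
  rw [bohrIndex, Finsupp.prod_embDomain]
  exact Finset.prod_ne_zero_iff.2 fun i _ => pow_ne_zero _ (prime_nthPrime i).ne_zero

theorem bohrExponent_bohrIndex (α : ℕ →₀ ℕ) : bohrExponent (bohrIndex α) = α := by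
  simp only [bohrExponent, factorization_bohrIndex, Finsupp.comapDomain_embDomain]

theorem bohrIndex_injective : Function.Injective bohrIndex :=
  Function.LeftInverse.injective bohrExponent_bohrIndex

theorem bohrIndex_bohrExponent {n : ℕ} (hn : n ≠ 0) : bohrIndex (bohrExponent n) = n := by
  rw [bohrIndex, bohrExponent, Finsupp.embDomain_comapDomain,
    Nat.prod_factorization_pow_eq_self hn]
  exact fun p hp => range_nthPrime ▸ Nat.prime_of_mem_primeFactors hp

theorem norm_natCast_cpow_neg_le_one {n : ℕ} (hn : n ≠ 0) {s : ℂ} (hs : 0 ≤ s.re) :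
    ‖(n : ℂ) ^ (-s)‖ ≤ 1 := by
  rw [Complex.norm_natCast_cpow_of_pos hn.bot_lt]
  exact Real.rpow_le_one_of_one_le_of_nonpos
    (Nat.one_le_cast.2 hn.bot_lt) (neg_nonpos.2 hs)

/-- Bohr's substitution `s ↦ (pᵢ⁻ˢ)ᵢ`, with values in the closed polydisc. -/
noncomputable def bohrPoint : C(rightHalfPlane, ClosedPolydisc) where
  toFun s i := ⟨(nthPrime i : ℂ) ^ (-(s : ℂ)), by
    rw [mem_closedBall_zero_iff]
    exact norm_natCast_cpow_neg_le_one (prime_nthPrime i).ne_zero (le_of_lt s.2)⟩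
  continuous_toFun := continuous_pi fun i => Continuous.subtype_mk (Continuous.const_cpow
    (by fun_prop) (Or.inl (Nat.cast_ne_zero.2 (prime_nthPrime i).ne_zero))) _

theorem prod_bohrPoint_pow (s : rightHalfPlane) (α : ℕ →₀ ℕ) :
    (α.prod fun i k => (bohrPoint s i : ℂ) ^ k) = (bohrIndex α : ℂ) ^ (-(s : ℂ)) := by
  have hs : (s : ℂ) ≠ 0 := fun h => lt_irrefl (0 : ℝ) (by simpa [rightHalfPlane, h] using s.2)
  rw [bohrIndex, Finsupp.prod_embDomain]
  exact ((map_finsuppProd (riemannZetaSummandHom hs) α _).trans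
    (Finsupp.prod_congr fun i _ => map_pow _ _ _)).symm

theorem aeval_coord_apply (Q : MvPolynomial ℕ ℂ) (z : ClosedPolydisc) :
    MvPolynomial.aeval coord Q z =
      ∑ α ∈ Q.support, Q.coeff α * α.prod fun i k => (z i : ℂ) ^ k := by
  simp only [MvPolynomial.aeval_def, MvPolynomial.eval₂_eq, ContinuousMap.sum_apply,
    ContinuousMap.mul_apply, ContinuousMap.prod_apply, ContinuousMap.pow_apply, coord_apply]
  rfl

theorem aeval_coord_bohrPoint (Q : MvPolynomial ℕ ℂ) (s : rightHalfPlane) :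
    MvPolynomial.aeval coord Q (bohrPoint s) =
      ∑ α ∈ Q.support, Q.coeff α * (bohrIndex α : ℂ) ^ (-(s : ℂ)) := by
  simp only [aeval_coord_apply, prod_bohrPoint_pow]

theorem norm_coeff_le_norm_pullback (Q : MvPolynomial ℕ ℂ) {α : ℕ →₀ ℕ} (hα : α ∈ Q.support) :
    ‖Q.coeff α‖ ≤ ‖pullback bohrPoint (MvPolynomial.aeval coord Q)‖ := by
  refine norm_coeff_le_of_dirichletSum (c := Q.coeff) bohrIndex_injective.injOn
    (fun β _ => bohrIndex_ne_zero β) (fun s hs => ?_) hα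
  rw [← aeval_coord_bohrPoint Q ⟨s, hs⟩]
  exact (pullback bohrPoint (MvPolynomial.aeval coord Q)).norm_coe_le_norm _

theorem norm_aeval_coord_le (Q : MvPolynomial ℕ ℂ) :
    ‖MvPolynomial.aeval coord Q‖ ≤
      Q.support.card * ‖pullback bohrPoint (MvPolynomial.aeval coord Q)‖ := by
  refine (ContinuousMap.norm_le _ (by positivity)).2 fun z => ?_
  rw [aeval_coord_apply, ← nsmul_eq_mul, ← Finset.sum_const]
  refine norm_sum_le_of_le _ fun α hα => ?_
  rw [norm_mul, Finsupp.prod, norm_prod]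
  refine (mul_le_of_le_one_right (norm_nonneg _) ?_).trans (norm_coeff_le_norm_pullback Q hα)
  refine Finset.prod_le_one (fun _ _ => norm_nonneg _) fun i _ => ?_
  rw [norm_pow]
  exact pow_le_one₀ (norm_nonneg _) (mem_closedBall_zero_iff.1 (z i).2)

theorem card_support_pow_le {σ R : Type*} [CommSemiring R] (Q : MvPolynomial σ R) (k : ℕ) :
    (Q ^ k).support.card ≤ (k * Q.totalDegree + 1) ^ Q.vars.card := by
  classical
  have hsub : (Q ^ k).support ⊆
      Q.vars.finsupp fun _ => Finset.range (k * Q.totalDegree + 1) := fun α hα => by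
    refine Finset.mem_finsupp_iff.2 ⟨fun i hi => MvPolynomial.vars_pow Q k
      ((MvPolynomial.mem_vars_iff_mem_support i).2 ⟨α, hα, hi⟩), fun i _ => ?_⟩
    rw [Finset.mem_range, Nat.lt_succ_iff]
    calc α i ≤ α.degree := Finsupp.le_degree i α
      _ ≤ (Q ^ k).totalDegree := MvPolynomial.le_totalDegree hα
      _ ≤ k * Q.totalDegree := MvPolynomial.totalDegree_pow Q k
  refine (Finset.card_le_card hsub).trans_eq ?_
  rw [Finset.card_finsupp, Finset.prod_const, Finset.card_range]

theorem le_of_forall_pow_le {x M : ℝ} {d v : ℕ} (hM : 0 ≤ M)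
    (h : ∀ k : ℕ, 0 < k → x ^ k ≤ ((k * d + 1 : ℕ) : ℝ) ^ v * M ^ k) : x ≤ M := by
  by_contra! hlt
  have hx : 0 < x := hM.trans_lt hlt
  have hq : |M / x| < 1 := by rwa [abs_of_nonneg (by positivity), div_lt_one hx]
  have hlim := (tendsto_pow_const_mul_const_pow_of_abs_lt_one v hq).const_mul (((d : ℝ) + 1) ^ v)
  rw [mul_zero] at hlim
  refine absurd (ge_of_tendsto hlim ?_) (not_le_of_gt (zero_lt_one' ℝ))
  filter_upwards [eventually_ge_atTop 1] with k hk
  have hlin : ((k * d + 1 : ℕ) : ℝ) ≤ (d + 1) * k := by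
    have : (1 : ℝ) ≤ k := Nat.one_le_cast.2 hk
    push_cast
    linarith
  rw [div_pow, ← mul_assoc, ← mul_pow, ← mul_div_assoc, one_le_div (pow_pos hx k)]
  exact (h k hk).trans (by gcongr)

/-- The bound by the number of coefficients is applied to `Q ^ k`; after taking `k`-th roots this
number, which grows polynomially in `k`, disappears in the limit. -/
theorem norm_le_norm_pullback_bohrPoint :
    ∀ g ∈ polydiscAlgebra, ‖g‖ ≤ ‖pullback bohrPoint g‖ := by
  refine norm_le_norm_pullback_of_adjoin fun g hg => ?_
  rw [Algebra.adjoin_range_eq_range_aeval] at hg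
  obtain ⟨Q, rfl⟩ := hg
  set P := MvPolynomial.aeval coord Q
  refine (ContinuousMap.norm_le _ (norm_nonneg _)).2 fun z => ?_
  refine le_of_forall_pow_le (d := Q.totalDegree) (v := Q.vars.card) (norm_nonneg _) fun k hk => ?_
  calc ‖P z‖ ^ k = ‖(P ^ k) z‖ := (norm_pow (P z) k).symm
    _ ≤ ‖P ^ k‖ := (P ^ k).norm_coe_le_norm z
    _ ≤ (Q ^ k).support.card * ‖pullback bohrPoint (P ^ k)‖ := by
      simpa only [map_pow] using norm_aeval_coord_le (Q ^ k)
    _ ≤ ((k * Q.totalDegree + 1 : ℕ) : ℝ) ^ Q.vars.card * ‖pullback bohrPoint P‖ ^ k := by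
      gcongr
      · exact_mod_cast card_support_pow_le Q k
      · rw [map_pow]
        exact norm_pow_le' (pullback bohrPoint P) hk

end BohrLift

section Perron

open MeasureTheory

theorem integrable_norm_rpow_neg_verticalLine {σ r : ℝ} (hσ : 0 < σ) (hr : 1 < r) :
    Integrable fun y : ℝ => ‖(σ + y * Complex.I : ℂ)‖ ^ (-r) := by
  have hfinrank : (Module.finrank ℝ ℝ : ℝ) < r := by simpa using hr
  refine (((integrable_rpow_neg_one_add_norm_sq (μ := volume) hfinrank).comp_div
    hσ.ne').const_mul (σ ^ (-r))).congr (Eventually.of_forall fun y => ?_)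
  have hnorm : ‖(σ + y * Complex.I : ℂ)‖ = (σ ^ 2 * (1 + ‖y / σ‖ ^ 2)) ^ (1 / 2 : ℝ) := by
    rw [Complex.norm_add_mul_I, Real.sqrt_eq_rpow, Real.norm_eq_abs, sq_abs, div_pow]
    field_simp
  simp only [hnorm]
  rw [← Real.rpow_mul (by positivity), Real.mul_rpow (by positivity) (by positivity),
    ← Real.rpow_natCast_mul hσ.le]
  congr 2 <;> push_cast <;> ring

theorem verticalLine_ne_zero {σ : ℝ} (hσ : 0 < σ) (y : ℝ) : (σ + y * Complex.I : ℂ) ≠ 0 :=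
  fun h => hσ.ne' (by simpa using congrArg Complex.re h)

theorem ofReal_posLog_inv {t : ℝ} (ht : 0 < t) :
    (Real.posLog t⁻¹ : ℂ) = (-1 : ℂ) • Real.log t • indicator (Ioc 0 1) (fun _ => (1 : ℂ)) t := by
  rw [Real.posLog_apply, Real.log_inv]
  rcases le_or_gt t 1 with h | h
  · rw [indicator_of_mem (mem_Ioc.2 ⟨ht, h⟩),
      max_eq_right (neg_nonneg.2 (Real.log_nonpos ht.le h))]
    simp
  · rw [indicator_of_notMem fun h' => h.not_ge (mem_Ioc.1 h').2,
      max_eq_left (neg_nonpos.2 (Real.log_nonneg h.le))]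
    simp

/-- Since `log⁺ (1 / t) = -log t` on `(0, 1]`, this is the derivative of the transform `1 / s` of
the indicator function of `(0, 1]`. -/
theorem hasMellin_posLog_inv {s : ℂ} (hs : 0 < s.re) :
    HasMellin (fun t => (Real.posLog t⁻¹ : ℂ)) s (1 / s ^ 2) := by
  set f : ℝ → ℂ := indicator (Ioc 0 1) fun _ => 1
  have hf : LocallyIntegrableOn f (Ioi 0) := by
    have hIoc : IntegrableOn (fun _ => (1 : ℂ)) (Ioc (0 : ℝ) 1) := integrableOn_const (by simp)
    exact (hIoc.integrable_indicator measurableSet_Ioc).locallyIntegrable.locallyIntegrableOn _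
  have hf_top : f =O[atTop] fun t => t ^ (-(s.re + 1)) := by
    refine (Asymptotics.isBigO_zero _ _).congr' ?_ .rfl
    filter_upwards [eventually_gt_atTop 1] with t ht
    exact (indicator_of_notMem (fun h => ht.not_ge h.2) _).symm
  have hf_bot : f =O[𝓝[>] 0] fun t => t ^ (-(0 : ℝ)) := by
    refine .of_bound' (.of_forall fun t => ?_)
    rw [neg_zero, Real.rpow_zero, norm_one]
    exact (norm_indicator_le_norm_self _ _).trans_eq norm_one
  obtain ⟨hconv, hderiv⟩ := mellin_hasDerivAt_of_isBigO_rpow hf hf_top (lt_add_one _) hf_bot hs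
  have hmellin : mellin f =ᶠ[𝓝 s] fun z => z⁻¹ := by
    filter_upwards [(isOpen_lt continuous_const Complex.continuous_re).mem_nhds hs] with z hz
    rw [(hasMellin_one_Ioc hz).2, one_div]
  have hs0 : s ≠ 0 := fun h => hs.ne' (by rw [h, Complex.zero_re])
  have hval := hderiv.unique ((hasDerivAt_inv hs0).congr_of_eventuallyEq hmellin)
  have hcongr : EqOn (fun t : ℝ => (t : ℂ) ^ (s - 1) • ((-1 : ℂ) • Real.log t • f t))
      (fun t => (t : ℂ) ^ (s - 1) • (Real.posLog t⁻¹ : ℂ)) (Ioi 0) := fun t ht => by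
    simp only [ofReal_posLog_inv ht, f]
  refine ⟨(hconv.const_smul (-1 : ℂ)).congr_fun hcongr measurableSet_Ioi, ?_⟩
  rw [mellin, ← setIntegral_congr_fun measurableSet_Ioi hcongr]
  exact (mellin_const_smul _ s (-1 : ℂ)).trans (by rw [hval]; simp)

theorem verticalIntegrable_one_div_sq {σ : ℝ} (hσ : 0 < σ) :
    Complex.VerticalIntegrable (fun s => 1 / s ^ 2) σ := by
  refine (integrable_norm_iff ?_).1 ?_
  · exact Continuous.aestronglyMeasurable <| Continuous.div (by fun_prop) (by fun_prop)
      fun y => pow_ne_zero 2 (verticalLine_ne_zero hσ y)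
  · simpa [Real.rpow_neg] using integrable_norm_rpow_neg_verticalLine hσ one_lt_two

theorem integrable_cpow_div_sq_verticalLine {σ x : ℝ} (hσ : 0 < σ) (hx : 0 < x) :
    Integrable fun y : ℝ => (x : ℂ) ^ (σ + y * Complex.I) / (σ + y * Complex.I) ^ 2 := by
  have hcont : Continuous fun y : ℝ => (x : ℂ) ^ (σ + y * Complex.I) :=
    .const_cpow (by fun_prop) (.inl (Complex.ofReal_ne_zero.2 hx.ne'))
  simp only [div_eq_mul_one_div (_ ^ _)]
  exact (verticalIntegrable_one_div_sq hσ).bdd_mul hcont.aestronglyMeasurable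
    (.of_forall fun y => (by simp [Complex.norm_cpow_eq_rpow_re_of_pos hx] : _ ≤ x ^ σ))

theorem integral_cpow_div_sq_verticalLine {σ x : ℝ} (hσ : 0 < σ) (hx : 0 < x) :
    ∫ y : ℝ, (x : ℂ) ^ (σ + y * Complex.I) / (σ + y * Complex.I) ^ 2 =
      2 * Real.pi * Real.posLog x := by
  have hmellin : ∀ y : ℝ, mellin (fun t => ((Real.posLog t⁻¹ : ℝ) : ℂ)) (σ + y * Complex.I) =
      1 / (σ + y * Complex.I) ^ 2 := fun y => (hasMellin_posLog_inv (by simpa using hσ)).2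
  have hinv := mellinInv_mellin_eq σ (fun t => ((Real.posLog t⁻¹ : ℝ) : ℂ)) (inv_pos.2 hx)
    (hasMellin_posLog_inv (by simpa using hσ)).1
    ((verticalIntegrable_one_div_sq hσ).congr (.of_forall fun y => (hmellin y).symm))
    ((Complex.continuous_ofReal.comp Real.continuous_posLog).continuousAt.comp
      (continuousAt_inv₀ (inv_pos.2 hx).ne'))
  have hcpow : ∀ w : ℂ, ((x⁻¹ : ℝ) : ℂ) ^ (-w) = x ^ w := fun w => by
    have harg : (x : ℂ).arg ≠ Real.pi := by
      rw [Complex.arg_ofReal_of_nonneg hx.le]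
      exact Real.pi_pos.ne
    rw [Complex.ofReal_inv, Complex.inv_cpow _ _ harg, Complex.cpow_neg, inv_inv]
  rw [inv_inv] at hinv
  rw [← hinv, mellinInv]
  simp only [hmellin, hcpow, smul_eq_mul, mul_one_div]
  rw [Complex.real_smul, ← mul_assoc]
  push_cast
  rw [mul_one_div_cancel (by simp [Real.pi_ne_zero]), one_mul]

theorem norm_cpow_neg_sub_le_mul {v : ℂ} (hv : 0 ≤ v.re) {a b : ℝ} (ha : 0 < a) (hab : a ≤ b) :
    ‖(a : ℂ) ^ (-v) - (b : ℂ) ^ (-v)‖ ≤ ‖v‖ * a ^ (-v.re - 1) * (b - a) := by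
  have hderiv : ∀ x ∈ Icc a b, HasDerivWithinAt (fun x : ℝ => (x : ℂ) ^ (-v))
      (-v * (x : ℂ) ^ (-v - 1)) (Icc a b) x := fun x hx => by
    have hx0 : (x : ℂ) ∈ Complex.slitPlane := Complex.ofReal_mem_slitPlane.2 (ha.trans_le hx.1)
    exact ((hasDerivAt_id (x : ℂ)).cpow_const hx0 |>.comp_ofReal.congr_deriv
      (by simp)).hasDerivWithinAt
  rw [norm_sub_rev]
  refine norm_image_sub_le_of_norm_deriv_le_segment' hderiv (fun x hx => ?_) b (right_mem_Icc.2 hab)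
  rw [norm_mul, norm_neg, Complex.norm_cpow_eq_rpow_re_of_pos (ha.trans_le hx.1)]
  gcongr ?_ * ?_
  exact Real.rpow_le_rpow_of_nonpos ha hx.1 (by simp; linarith)

theorem norm_natCast_cpow_neg_sub_le {v : ℂ} (hv : 0 ≤ v.re) (hv1 : v.re ≤ 1) {N : ℕ}
    (hN : 1 ≤ N) :
    ‖(N : ℂ) ^ (-v) - ((N + 1 : ℕ) : ℂ) ^ (-v)‖ ≤ 2 * ‖v‖ ^ (1 - v.re) / N := by
  set σ := v.re
  set d := ‖(N : ℂ) ^ (-v) - ((N + 1 : ℕ) : ℂ) ^ (-v)‖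
  have hN0 : (0 : ℝ) < N := Nat.cast_pos.2 hN
  have hnorm : ∀ n : ℕ, N ≤ n → ‖(n : ℂ) ^ (-v)‖ ≤ (N : ℝ) ^ (-σ) := fun n hn => by
    rw [Complex.norm_natCast_cpow_of_pos (by lia), Complex.neg_re]
    exact Real.rpow_le_rpow_of_nonpos hN0 (Nat.cast_le.2 hn) (neg_nonpos.2 hv)
  have htriv : d ≤ 2 * (N : ℝ) ^ (-σ) := by
    rw [two_mul]
    exact (norm_sub_le _ _).trans (add_le_add (hnorm N le_rfl) (hnorm _ N.le_succ))
  have hmvt : d ≤ ‖v‖ * (N : ℝ) ^ (-σ - 1) := by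
    simpa [d] using norm_cpow_neg_sub_le_mul hv hN0 (b := (N + 1 : ℕ)) (by simp)
  calc d = d ^ σ * d ^ (1 - σ) := by
        rw [← Real.rpow_add_of_nonneg (norm_nonneg _) hv (sub_nonneg.2 hv1), add_sub_cancel,
          Real.rpow_one]
    _ ≤ (2 * (N : ℝ) ^ (-σ)) ^ σ * (‖v‖ * (N : ℝ) ^ (-σ - 1)) ^ (1 - σ) := by
        gcongr
    _ = 2 ^ σ * ‖v‖ ^ (1 - σ) / N := by
        rw [Real.mul_rpow (by positivity) (by positivity), Real.mul_rpow (by positivity)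
          (by positivity), ← Real.rpow_mul hN0.le, ← Real.rpow_mul hN0.le, mul_mul_mul_comm,
          ← Real.rpow_add hN0, div_eq_mul_inv, ← Real.rpow_neg_one]
        congr 2
        ring
    _ ≤ 2 * ‖v‖ ^ (1 - σ) / N := by
        gcongr
        exact Real.rpow_le_self_of_one_le one_le_two hv1

theorem ite_log_one_add_inv {N n : ℕ} (hN : 1 ≤ N) (hn : n ≠ 0) :
    (if N < n then Real.log (1 + (N : ℝ)⁻¹) else 0) =
      Real.posLog (n / N) - Real.posLog (n / (N + 1 : ℕ)) := by
  have hN0 : (0 : ℝ) < N := Nat.cast_pos.2 hN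
  have hn0 : (0 : ℝ) < n := Nat.cast_pos.2 hn.bot_lt
  have hN1 : (0 : ℝ) < (N + 1 : ℕ) := Nat.cast_pos.2 N.succ_pos
  split_ifs with h
  · have hlog : ∀ m : ℕ, 0 < m → m ≤ n → Real.posLog (n / m) = Real.log n - Real.log m :=
      fun m hm hmn => by
        have hm0 : (0 : ℝ) < m := Nat.cast_pos.2 hm
        rw [Real.posLog_eq_log, Real.log_div hn0.ne' hm0.ne']
        rw [abs_of_pos (by positivity), one_le_div hm0]
        exact Nat.cast_le.2 hmn
    rw [hlog N hN h.le, hlog (N + 1) N.succ_pos h, sub_sub_sub_cancel_left,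
      ← Real.log_div hN1.ne' hN0.ne', Nat.cast_succ, add_div, div_self hN0.ne', one_div]
  · have hlog : ∀ m : ℕ, n ≤ m → Real.posLog (n / m) = 0 := fun m hm => by
      rw [Real.posLog_eq_zero_iff, abs_of_nonneg (by positivity)]
      exact div_le_one_of_le₀ (Nat.cast_le.2 hm) m.cast_nonneg
    rw [hlog N (not_lt.1 h), hlog (N + 1) (by lia), sub_zero]

theorem cpow_div_natCast {x : ℝ} (hx : 0 ≤ x) (m : ℕ) (v : ℂ) :
    ((x / m : ℝ) : ℂ) ^ v = (x : ℂ) ^ v * (m : ℂ) ^ (-v) := by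
  have harg : (m : ℂ).arg ≠ Real.pi := by
    rw [Complex.natCast_arg]
    exact Real.pi_pos.ne
  rw [div_eq_mul_inv, Complex.ofReal_mul, Complex.mul_cpow_ofReal_nonneg hx (by positivity),
    Complex.ofReal_inv, Complex.ofReal_natCast, Complex.inv_cpow _ _ harg, Complex.cpow_neg]

/-- The kernel whose integral along a vertical line cuts a Dirichlet series after its `N`-th
term. -/
noncomputable def cutoffKernel (N : ℕ) (v : ℂ) : ℂ :=
  ((N : ℂ) ^ (-v) - ((N + 1 : ℕ) : ℂ) ^ (-v)) / v ^ 2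

theorem norm_cutoffKernel_le {v : ℂ} (hv : 0 < v.re) (hv1 : v.re ≤ 1) {N : ℕ} (hN : 1 ≤ N) :
    ‖cutoffKernel N v‖ ≤ 2 / N * ‖v‖ ^ (-(1 + v.re)) := by
  have hv0 : 0 < ‖v‖ := hv.trans_le (Complex.re_le_norm v)
  have hexp : ‖v‖ ^ (-(1 + v.re)) = ‖v‖ ^ (1 - v.re) / ‖v‖ ^ 2 := by
    rw [← Real.rpow_natCast, ← Real.rpow_sub hv0]
    congr 1
    push_cast
    ring
  rw [cutoffKernel, norm_div, norm_pow, hexp, ← mul_div_assoc, div_mul_eq_mul_div]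
  gcongr
  exact norm_natCast_cpow_neg_sub_le hv.le hv1 hN

theorem cpow_mul_cutoffKernel (N n : ℕ) (v : ℂ) :
    (n : ℂ) ^ v * cutoffKernel N v =
      ((n / N : ℝ) : ℂ) ^ v / v ^ 2 - ((n / (N + 1 : ℕ) : ℝ) : ℂ) ^ v / v ^ 2 := by
  rw [cpow_div_natCast n.cast_nonneg, cpow_div_natCast n.cast_nonneg, Complex.ofReal_natCast,
    cutoffKernel]
  ring

theorem integrable_cpow_mul_cutoffKernel {σ : ℝ} (hσ : 0 < σ) {N n : ℕ} (hN : 1 ≤ N)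
    (hn : n ≠ 0) :
    Integrable fun y : ℝ =>
      (n : ℂ) ^ (σ + y * Complex.I) * cutoffKernel N (σ + y * Complex.I) := by
  have hn0 : (0 : ℝ) < n := Nat.cast_pos.2 hn.bot_lt
  simp only [cpow_mul_cutoffKernel]
  exact (integrable_cpow_div_sq_verticalLine hσ (div_pos hn0 (Nat.cast_pos.2 hN))).sub
    (integrable_cpow_div_sq_verticalLine hσ (div_pos hn0 (Nat.cast_pos.2 N.succ_pos)))

theorem integral_cpow_mul_cutoffKernel {σ : ℝ} (hσ : 0 < σ) {N n : ℕ} (hN : 1 ≤ N)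
    (hn : n ≠ 0) :
    ∫ y : ℝ, (n : ℂ) ^ (σ + y * Complex.I) * cutoffKernel N (σ + y * Complex.I) =
      2 * Real.pi * (if N < n then Real.log (1 + (N : ℝ)⁻¹) else 0 : ℝ) := by
  have hn0 : (0 : ℝ) < n := Nat.cast_pos.2 hn.bot_lt
  have hdiv : (0 : ℝ) < n / N := div_pos hn0 (Nat.cast_pos.2 hN)
  have hdiv' : (0 : ℝ) < n / (N + 1 : ℕ) := div_pos hn0 (Nat.cast_pos.2 N.succ_pos)
  simp only [cpow_mul_cutoffKernel]
  rw [integral_sub (integrable_cpow_div_sq_verticalLine hσ hdiv)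
    (integrable_cpow_div_sq_verticalLine hσ hdiv'), integral_cpow_div_sq_verticalLine hσ hdiv,
    integral_cpow_div_sq_verticalLine hσ hdiv', ← mul_sub, ← Complex.ofReal_sub,
    ← ite_log_one_add_inv hN hn]

variable {ι : Type*} {S : Finset ι} {c : ι → ℂ} {n : ι → ℕ}

theorem log_mul_dirichlet_tail {σ : ℝ} (hσ : 0 < σ) (s : ℂ) (hn : ∀ α ∈ S, n α ≠ 0) {N : ℕ}
    (hN : 1 ≤ N) :
    2 * Real.pi * Real.log (1 + (N : ℝ)⁻¹) * ∑ α ∈ S with N < n α, c α * (n α : ℂ) ^ (-s) =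
      ∫ y : ℝ, (∑ α ∈ S, c α * (n α : ℂ) ^ (-(s - (σ + y * Complex.I)))) *
        cutoffKernel N (σ + y * Complex.I) := by
  have hcpow : ∀ α ∈ S, ∀ w : ℂ, (n α : ℂ) ^ (-(s - w)) = (n α : ℂ) ^ (-s) * (n α : ℂ) ^ w :=
    fun α hα w => by
      rw [neg_sub, sub_eq_neg_add, Complex.cpow_add _ _ (Nat.cast_ne_zero.2 (hn α hα))]
  simp only [Finset.sum_mul]
  rw [integral_finsetSum, Finset.mul_sum, Finset.sum_filter]
  · refine Finset.sum_congr rfl fun α hα => ?_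
    simp only [hcpow α hα, mul_assoc, integral_const_mul,
      integral_cpow_mul_cutoffKernel hσ hN (hn α hα)]
    split_ifs
    · ring
    · simp
  · intro α hα
    simp only [hcpow α hα, mul_assoc]
    exact ((integrable_cpow_mul_cutoffKernel hσ hN (hn α hα)).const_mul _).const_mul _

/-- Both sides of `log_mul_dirichlet_tail` are of order `1 / N`, so the bound is uniform in `N`. -/
theorem norm_dirichlet_tail_le {σ : ℝ} (hσ : 0 < σ) (hσ1 : σ ≤ 1) {s : ℂ} (hs : σ < s.re)
    (hn : ∀ α ∈ S, n α ≠ 0) {M : ℝ}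
    (hM : ∀ w : ℂ, 0 < w.re → ‖∑ α ∈ S, c α * (n α : ℂ) ^ (-w)‖ ≤ M) {N : ℕ} (hN : 1 ≤ N) :
    ‖∑ α ∈ S with N < n α, c α * (n α : ℂ) ^ (-s)‖ ≤
      M * ∫ y : ℝ, ‖(σ + y * Complex.I : ℂ)‖ ^ (-(1 + σ)) := by
  set T := ∑ α ∈ S with N < n α, c α * (n α : ℂ) ^ (-s)
  set I := ∫ y : ℝ, ‖(σ + y * Complex.I : ℂ)‖ ^ (-(1 + σ))
  have hN1 : (1 : ℝ) ≤ N := Nat.one_le_cast.2 hN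
  have hM0 : 0 ≤ M := (norm_nonneg _).trans (hM 1 (by simp))
  have hkernel : ∀ y : ℝ, ‖cutoffKernel N (σ + y * Complex.I)‖ ≤
      2 / N * ‖(σ + y * Complex.I : ℂ)‖ ^ (-(1 + σ)) := fun y => by
    have hre : (σ + y * Complex.I : ℂ).re = σ := by simp
    simpa only [hre] using norm_cutoffKernel_le (hσ.trans_eq hre.symm) (hre.trans_le hσ1) hN
  have hupper : 2 * Real.pi * Real.log (1 + (N : ℝ)⁻¹) * ‖T‖ ≤ M * (2 / N * I) := by
    have hre : ∀ y : ℝ, 0 < (s - (σ + y * Complex.I)).re := fun y => by simpa using hs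
    have hbound := norm_integral_le_of_norm_le
      (((integrable_norm_rpow_neg_verticalLine hσ (by linarith : 1 < 1 + σ)).const_mul
        (2 / (N : ℝ))).const_mul M) (.of_forall fun y => (norm_mul_le _ _).trans <|
          mul_le_mul (hM _ (hre y)) (hkernel y) (norm_nonneg _) hM0)
    rw [← log_mul_dirichlet_tail hσ s hn hN, integral_const_mul, integral_const_mul] at hbound
    rwa [norm_mul, norm_mul, norm_mul, Complex.norm_ofNat, Complex.norm_real, Complex.norm_real,
      Real.norm_of_nonneg Real.pi_nonneg, Real.norm_of_nonneg (Real.log_nonneg (by simp))] at hbound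
  have hlog : 2 / (N : ℝ) ≤ 2 * Real.pi * Real.log (1 + (N : ℝ)⁻¹) := by
    have hlog : (2 * N : ℝ)⁻¹ ≤ Real.log (1 + (N : ℝ)⁻¹) := by
      refine le_trans ?_ (Real.one_sub_inv_le_log_of_pos (by positivity))
      field_simp
      linarith
    calc 2 / (N : ℝ) = 2 * 2 * (2 * N : ℝ)⁻¹ := by field_simp
      _ ≤ 2 * Real.pi * Real.log (1 + (N : ℝ)⁻¹) := by
        gcongr
        exact Real.two_le_pi
  refine le_of_mul_le_mul_left (a := 2 / (N : ℝ)) ?_ (by positivity)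
  calc 2 / (N : ℝ) * ‖T‖ ≤ 2 * Real.pi * Real.log (1 + (N : ℝ)⁻¹) * ‖T‖ := by gcongr
    _ ≤ 2 / N * (M * I) := by linarith

end Perron

section BohrLiftSeries

theorem sum_Icc_coeff_bohrExponent (Q : MvPolynomial ℕ ℂ) (s : ℂ) (N : ℕ) :
    ∑ n ∈ Finset.Icc 1 N, Q.coeff (bohrExponent n) / (n : ℂ) ^ s =
      ∑ α ∈ Q.support with bohrIndex α ≤ N, Q.coeff α * (bohrIndex α : ℂ) ^ (-s) := by
  refine (Finset.sum_of_injOn bohrIndex bohrIndex_injective.injOn (fun α hα => ?_)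
    (fun n hn hnot => ?_) fun α _ => ?_).symm
  · exact Finset.mem_Icc.2 ⟨(bohrIndex_ne_zero α).bot_lt, (Finset.mem_filter.1 hα).2⟩
  · obtain ⟨hn1, hnN⟩ := Finset.mem_Icc.1 hn
    have hindex : bohrIndex (bohrExponent n) = n := bohrIndex_bohrExponent (by lia)
    have hsupport : bohrExponent n ∉ Q.support := fun h =>
      hnot ⟨bohrExponent n, Finset.mem_filter.2 ⟨h, hindex.trans_le hnN⟩, hindex⟩
    rw [MvPolynomial.notMem_support_iff.1 hsupport, zero_div]
  · rw [bohrExponent_bohrIndex, Complex.cpow_neg, div_eq_mul_inv]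

theorem exists_norm_sum_coeff_bohrExponent_le (s : rightHalfPlane) :
    ∃ C : ℝ, ∀ (Q : MvPolynomial ℕ ℂ) (N : ℕ),
      ‖∑ n ∈ Finset.Icc 1 N, Q.coeff (bohrExponent n) / (n : ℂ) ^ (s : ℂ)‖ ≤
        C * ‖pullback bohrPoint (MvPolynomial.aeval coord Q)‖ := by
  have hs : 0 < (s : ℂ).re := s.2
  set σ : ℝ := min ((s : ℂ).re / 2) 1
  have hσ : 0 < σ := by positivity
  have hσs : σ < (s : ℂ).re := (min_le_left _ _).trans_lt (half_lt_self hs)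
  set I := ∫ y : ℝ, ‖(σ + y * Complex.I : ℂ)‖ ^ (-(1 + σ))
  have hI : 0 ≤ I := MeasureTheory.integral_nonneg fun y => by positivity
  refine ⟨1 + I, fun Q N => ?_⟩
  set f := pullback bohrPoint (MvPolynomial.aeval coord Q)
  rcases N.eq_zero_or_pos with rfl | hN
  · simpa using mul_nonneg (add_nonneg zero_le_one hI) (norm_nonneg f)
  have htail := norm_dirichlet_tail_le (c := Q.coeff) (n := bohrIndex) hσ (min_le_right _ _) hσs
    (fun α _ => bohrIndex_ne_zero α) (fun w hw => (aeval_coord_bohrPoint Q ⟨w, hw⟩).symm ▸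
      f.norm_coe_le_norm ⟨w, hw⟩) hN
  have hsplit : ∑ n ∈ Finset.Icc 1 N, Q.coeff (bohrExponent n) / (n : ℂ) ^ (s : ℂ) = f s -
      ∑ α ∈ Q.support with N < bohrIndex α, Q.coeff α * (bohrIndex α : ℂ) ^ (-(s : ℂ)) := by
    rw [pullback_apply, aeval_coord_bohrPoint, sum_Icc_coeff_bohrExponent, eq_sub_iff_add_eq]
    simpa only [not_le] using Finset.sum_filter_add_sum_filter_not Q.support (bohrIndex · ≤ N) _
  rw [hsplit, one_add_mul, mul_comm I]
  exact (norm_sub_le _ _).trans (add_le_add (f.norm_coe_le_norm s) htail)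

theorem tendsto_sum_coeff_bohrExponent (Q : MvPolynomial ℕ ℂ) (s : rightHalfPlane) :
    Tendsto (fun N : ℕ => ∑ n ∈ Finset.Icc 1 N, Q.coeff (bohrExponent n) / (n : ℂ) ^ (s : ℂ)) atTop
      (𝓝 (MvPolynomial.aeval coord Q (bohrPoint s))) := by
  refine tendsto_const_nhds.congr' ?_
  filter_upwards [eventually_ge_atTop (Q.support.sup bohrIndex)] with N hN
  rw [aeval_coord_bohrPoint, sum_Icc_coeff_bohrExponent, Finset.filter_true_of_mem]
  exact fun α hα => (Finset.le_sup hα).trans hN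

theorem exists_tendsto_aeval_coord {g : C(ClosedPolydisc, ℂ)} (hg : g ∈ polydiscAlgebra) :
    ∃ Q : ℕ → MvPolynomial ℕ ℂ, Tendsto (fun k => MvPolynomial.aeval coord (Q k)) atTop (𝓝 g) := by
  obtain ⟨P, hP, hlim⟩ := mem_closure_iff_seq_limit.1 (polydiscAlgebra_le_coordClosure hg)
  rw [Algebra.adjoin_range_eq_range_aeval] at hP
  choose Q hQ using hP
  exact ⟨Q, hlim.congr fun k => (hQ k).symm⟩

theorem exists_tendsto_coeff {Q : ℕ → MvPolynomial ℕ ℂ}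
    (hQ : CauchySeq fun k => pullback bohrPoint (MvPolynomial.aeval coord (Q k))) (α : ℕ →₀ ℕ) :
    ∃ A : ℂ, Tendsto (fun k => (Q k).coeff α) atTop (𝓝 A) := by
  refine cauchySeq_tendsto_of_complete (Metric.cauchySeq_iff.2 fun ε hε => ?_)
  obtain ⟨K, hK⟩ := Metric.cauchySeq_iff.1 hQ ε hε
  refine ⟨K, fun k hk l hl => lt_of_le_of_lt ?_ (hK k hk l hl)⟩
  rw [dist_eq_norm, dist_eq_norm, ← map_sub, ← map_sub, ← MvPolynomial.coeff_sub]
  by_cases hα : α ∈ (Q k - Q l).support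
  · exact norm_coeff_le_norm_pullback _ hα
  · rw [MvPolynomial.notMem_support_iff.1 hα, norm_zero]
    exact norm_nonneg _

theorem exists_dirichletSeries {g : C(ClosedPolydisc, ℂ)} (hg : g ∈ polydiscAlgebra) :
    ∃ a : ℕ → ℂ, ∀ s : rightHalfPlane,
      Tendsto (fun N : ℕ => ∑ n ∈ Finset.Icc 1 N, a n / (n : ℂ) ^ (s : ℂ)) atTop
        (𝓝 (g (bohrPoint s))) := by
  obtain ⟨Q, hQ⟩ := exists_tendsto_aeval_coord hg
  have hcauchy := (((continuous_pullback bohrPoint).tendsto g).comp hQ).cauchySeq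
  choose A hA using exists_tendsto_coeff hcauchy
  refine ⟨fun n => A (bohrExponent n), fun s => ?_⟩
  obtain ⟨C, hC⟩ := exists_norm_sum_coeff_bohrExponent_le s
  let F : ℕ → ℕ → ℂ := fun k N =>
    ∑ n ∈ Finset.Icc 1 N, (Q k).coeff (bohrExponent n) / (n : ℂ) ^ (s : ℂ)
  have hF : ∀ k l N, dist (F k N) (F l N) ≤
      C * dist (pullback bohrPoint (MvPolynomial.aeval coord (Q k)))
        (pullback bohrPoint (MvPolynomial.aeval coord (Q l))) := fun k l N => by
    simp only [F, dist_eq_norm, ← Finset.sum_sub_distrib, ← sub_div, ← MvPolynomial.coeff_sub,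
      ← map_sub]
    exact hC _ N
  have huniform : UniformCauchySeqOn F atTop univ := fun u hu => by
    obtain ⟨ε, hε, hεu⟩ := Metric.mem_uniformity_dist.1 hu
    have hzero := (cauchySeq_iff_tendsto_dist_atTop_0.1 hcauchy).const_mul C
    rw [mul_zero, ← prod_atTop_atTop_eq] at hzero
    filter_upwards [hzero.eventually (gt_mem_nhds hε)] with m hm N _
    exact hεu ((hF m.1 m.2 N).trans_lt hm)
  have hlim := huniform.tendstoUniformlyOn_of_tendsto fun N _ =>
    tendsto_finsetSum _ fun n _ => (hA (bohrExponent n)).div_const ((n : ℂ) ^ (s : ℂ))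
  exact (tendstoUniformlyOn_univ.1 hlim).tendsto_of_eventually_tendsto
    (.of_forall fun k => tendsto_sum_coeff_bohrExponent (Q k) s)
    (((continuous_eval_const (F := C(ClosedPolydisc, ℂ)) (bohrPoint s)).tendsto g).comp hQ)

theorem uniformContinuous_natCast_cpow_neg {n : ℕ} (hn : n ≠ 0) :
    UniformContinuous fun s : rightHalfPlane => (n : ℂ) ^ (-(s : ℂ)) := by
  have hderiv : ∀ s ∈ rightHalfPlane, HasDerivWithinAt (fun s : ℂ => (n : ℂ) ^ (-s))
      ((n : ℂ) ^ (-s) * Complex.log n * -1) rightHalfPlane s := fun s _ =>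
    ((hasDerivAt_neg s).const_cpow (Or.inl (Nat.cast_ne_zero.2 hn))).hasDerivWithinAt
  have hlip : LipschitzOnWith ‖Complex.log n‖₊ (fun s : ℂ => (n : ℂ) ^ (-s)) rightHalfPlane := by
    refine (convex_halfSpace_re_gt 0).lipschitzOnWith_of_nnnorm_hasDerivWithin_le hderiv
      fun s hs => ?_
    rw [nnnorm_mul, nnnorm_mul, nnnorm_neg, nnnorm_one, mul_one]
    exact mul_le_of_le_one_left zero_le (norm_natCast_cpow_neg_le_one hn (le_of_lt hs))
  exact hlip.to_restrict.uniformContinuous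

theorem uniformContinuous_bohrPoint : UniformContinuous bohrPoint :=
  uniformContinuous_pi.2 fun i =>
    (uniformContinuous_natCast_cpow_neg (prime_nthPrime i).ne_zero).subtype_mk _

theorem comp_bohrPoint_mem_dirichletFunctions {g : C(ClosedPolydisc, ℂ)}
    (hg : g ∈ polydiscAlgebra) : g ∘ bohrPoint ∈ dirichletFunctions :=
  ⟨(CompactSpace.uniformContinuous_of_continuous g.continuous).comp uniformContinuous_bohrPoint,
    exists_dirichletSeries hg⟩

end BohrLiftSeries

section ConvexDomain

variable {E F : Type*} [SeminormedAddCommGroup E] [NormedSpace ℝ E] [PseudoMetricSpace F]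

theorem exists_dist_le_add_mul_dist_of_uniformContinuous {s : Set E} (hs : Convex ℝ s) {f : s → F}
    (hf : UniformContinuous f) {η : ℝ} (hη : 0 < η) :
    ∃ B : ℝ, 0 ≤ B ∧ ∀ x y : s, dist (f x) (f y) ≤ η + B * dist x y := by
  obtain ⟨δ, hδ, hclose⟩ := Metric.uniformContinuous_iff.1 hf η hη
  refine ⟨η / δ, by positivity, fun x y => ?_⟩
  set k : ℕ := ⌊dist x y / δ⌋₊ + 1
  have hk : (0 : ℝ) < k := by positivity
  have hmesh : dist x y / k < δ := by
    have := Nat.lt_floor_add_one (dist x y / δ)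
    rw [div_lt_iff₀ hδ] at this
    rw [div_lt_iff₀' hk]
    exact_mod_cast this
  let t : ℕ → Icc (0 : ℝ) 1 := fun j => projIcc 0 1 zero_le_one ((j : ℝ) / k)
  let p : ℕ → s := fun j => ⟨AffineMap.lineMap (x : E) y (t j : ℝ), hs.lineMap_mem x.2 y.2 (t j).2⟩
  have hp0 : p 0 = x := Subtype.ext (by simp [p, t])
  have hpk : p k = y := Subtype.ext (by simp [p, t, hk.ne'])
  have hstep : ∀ j, dist (f (p j)) (f (p (j + 1))) ≤ η := fun j => by
    refine (hclose (lt_of_le_of_lt ?_ hmesh)).le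
    have hparam := abs_projIcc_sub_projIcc (zero_le_one (α := ℝ)) (c := (j : ℝ) / k)
      (d := ((j + 1 : ℕ) : ℝ) / k)
    rw [← sub_div, Nat.cast_succ j, sub_add_cancel_left, abs_div, abs_neg, abs_one,
      abs_of_pos hk] at hparam
    rw [Subtype.dist_eq, dist_lineMap_lineMap, Real.dist_eq, div_eq_inv_mul, ← one_div]
    exact mul_le_mul_of_nonneg_right (by simpa only [t, Nat.cast_succ j] using hparam) dist_nonneg
  calc dist (f x) (f y) = dist (f (p 0)) (f (p k)) := by rw [hp0, hpk]
    _ ≤ ∑ _j ∈ Finset.range k, η :=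
      dist_le_range_sum_of_dist_le (f := fun j => f (p j)) k fun {j} _ => hstep j
    _ = (⌊dist x y / δ⌋₊ + 1) * η := by simp [k]
    _ ≤ (dist x y / δ + 1) * η := by
      gcongr
      exact Nat.floor_le (by positivity)
    _ = η + η / δ * dist x y := by ring

theorem isBounded_range_of_uniformContinuous {s : Set E} (hs : Convex ℝ s)
    (hb : Bornology.IsBounded s) {f : s → F} (hf : UniformContinuous f) :
    Bornology.IsBounded (range f) := by
  obtain ⟨B, hB, hdist⟩ := exists_dist_le_add_mul_dist_of_uniformContinuous hs hf one_pos
  obtain ⟨K, hK⟩ := Metric.isBounded_iff.1 hb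
  refine Metric.isBounded_iff.2 ⟨1 + B * K, ?_⟩
  rintro _ ⟨x, rfl⟩ _ ⟨y, rfl⟩
  exact (hdist x y).trans (by gcongr; exact hK x.2 y.2)

end ConvexDomain

section AbelSummation

theorem sum_Icc_mul_eq_abel {R : Type*} [CommRing R] (b φ : ℕ → R) (N : ℕ) :
    ∑ n ∈ Finset.Icc 1 N, b n * φ n = (∑ n ∈ Finset.Icc 1 N, b n) * φ (N + 1) +
      ∑ n ∈ Finset.Icc 1 N, (∑ k ∈ Finset.Icc 1 n, b k) * (φ n - φ (n + 1)) := by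
  induction N with
  | zero => simp
  | succ N ih =>
    simp only [Finset.sum_Icc_succ_top (Nat.le_add_left 1 N), ih]
    ring

theorem norm_sum_Icc_mul_le {R : Type*} [SeminormedCommRing R] {b : ℕ → R} {M : ℝ}
    (hb : ∀ N, ‖∑ n ∈ Finset.Icc 1 N, b n‖ ≤ M) (φ : ℕ → R) (N : ℕ) :
    ‖∑ n ∈ Finset.Icc 1 N, b n * φ n‖ ≤
      M * (‖φ (N + 1)‖ + ∑ n ∈ Finset.Icc 1 N, ‖φ n - φ (n + 1)‖) := by
  rw [sum_Icc_mul_eq_abel, mul_add, Finset.mul_sum]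
  refine (norm_add_le _ _).trans (add_le_add ?_ (norm_sum_le_of_le _ fun n _ => ?_))
  all_goals exact (norm_mul_le _ _).trans (mul_le_mul_of_nonneg_right (hb _) (norm_nonneg _))

theorem exists_norm_sum_div_cpow_le {a : ℕ → ℂ} {w L : ℂ}
    (hL : Tendsto (fun N : ℕ => ∑ n ∈ Finset.Icc 1 N, a n / (n : ℂ) ^ w) atTop (𝓝 L))
    {σ : ℝ} (hσ : 0 < σ) : ∃ C : ℝ, 0 ≤ C ∧ ∀ (N : ℕ) (z : ℂ), σ ≤ z.re →
      ‖∑ n ∈ Finset.Icc 1 N, a n / (n : ℂ) ^ (w + z)‖ ≤ C * (1 + ‖z‖) := by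
  obtain ⟨M, hM⟩ := hL.norm.bddAbove_range
  replace hM N : ‖∑ n ∈ Finset.Icc 1 N, a n / (n : ℂ) ^ w‖ ≤ M := hM (mem_range_self N)
  have hM0 : 0 ≤ M := (norm_nonneg _).trans (hM 0)
  have hsummable : Summable fun n : ℕ => (n : ℝ) ^ (-σ - 1) :=
    Real.summable_nat_rpow.2 (by linarith)
  set R : ℝ := ∑' n : ℕ, (n : ℝ) ^ (-σ - 1)
  have hR : 0 ≤ R := tsum_nonneg fun n => by positivity
  refine ⟨M * (1 + R), by positivity, fun N z hz => ?_⟩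
  have hz0 : 0 ≤ z.re := hσ.le.trans hz
  have hterm : ∀ n ∈ Finset.Icc 1 N,
      a n / (n : ℂ) ^ (w + z) = a n / (n : ℂ) ^ w * (n : ℂ) ^ (-z) := fun n hn => by
    have hn0 : (n : ℂ) ≠ 0 := Nat.cast_ne_zero.2 (by have := Finset.mem_Icc.1 hn; lia)
    rw [Complex.cpow_add _ _ hn0, Complex.cpow_neg, div_mul_eq_div_div, ← div_eq_mul_inv]
  have hdiff : ∀ n ∈ Finset.Icc 1 N,
      ‖(n : ℂ) ^ (-z) - ((n + 1 : ℕ) : ℂ) ^ (-z)‖ ≤ ‖z‖ * (n : ℝ) ^ (-σ - 1) := fun n hn => by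
    have hn1 : (1 : ℝ) ≤ n := by exact_mod_cast (Finset.mem_Icc.1 hn).1
    have h := norm_cpow_neg_sub_le_mul hz0 (zero_lt_one.trans_le hn1) (lt_add_one (n : ℝ)).le
    rw [add_sub_cancel_left, mul_one] at h
    push_cast at h ⊢
    exact h.trans (by gcongr)
  have hvariation : ∑ n ∈ Finset.Icc 1 N, ‖(n : ℂ) ^ (-z) - ((n + 1 : ℕ) : ℂ) ^ (-z)‖ ≤ ‖z‖ * R :=
    (Finset.sum_le_sum hdiff).trans <| by
      rw [← Finset.mul_sum]
      exact mul_le_mul_of_nonneg_left (hsummable.sum_le_tsum _ fun n _ => by positivity)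
        (norm_nonneg z)
  rw [Finset.sum_congr rfl hterm]
  calc ‖∑ n ∈ Finset.Icc 1 N, a n / (n : ℂ) ^ w * (n : ℂ) ^ (-z)‖ ≤ M * (1 + ‖z‖ * R) :=
        (norm_sum_Icc_mul_le hM (fun n : ℕ => (n : ℂ) ^ (-z)) N).trans
          (mul_le_mul_of_nonneg_left (add_le_add
            (norm_natCast_cpow_neg_le_one (Nat.succ_ne_zero N) hz0) hvariation) hM0)
    _ ≤ M * (1 + R) * (1 + ‖z‖) := by nlinarith [mul_nonneg hM0 hR, mul_nonneg hM0 (norm_nonneg z)]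

theorem exists_norm_coeff_le_mul_norm_cpow {a : ℕ → ℂ} {w L : ℂ}
    (hL : Tendsto (fun N : ℕ => ∑ n ∈ Finset.Icc 1 N, a n / (n : ℂ) ^ w) atTop (𝓝 L)) :
    ∃ C : ℝ, ∀ n : ℕ, n ≠ 0 → ‖a n‖ ≤ C * ‖(n : ℂ) ^ w‖ := by
  obtain ⟨M, hM⟩ := hL.norm.bddAbove_range
  replace hM N : ‖∑ n ∈ Finset.Icc 1 N, a n / (n : ℂ) ^ w‖ ≤ M := hM (mem_range_self N)
  refine ⟨M + M, fun n hn => ?_⟩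
  obtain ⟨m, rfl⟩ := Nat.exists_eq_succ_of_ne_zero hn
  have hpow : ((m + 1 : ℕ) : ℂ) ^ w ≠ 0 := by
    simp [Complex.cpow_eq_zero_iff, Nat.cast_add_one_ne_zero]
  rw [← div_le_iff₀ (norm_pos_iff.2 hpow), ← norm_div]
  have hdiff := Finset.sum_Icc_succ_top (Nat.le_add_left 1 m) fun n : ℕ => a n / (n : ℂ) ^ w
  rw [← sub_eq_iff_eq_add'] at hdiff
  exact hdiff ▸ (norm_sub_le _ _).trans (add_le_add (hM _) (hM _))

end AbelSummation

section VerticalMeans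

open MeasureTheory

/-- The point `s + it` of the half-plane. -/
def verticalShift (s : rightHalfPlane) (t : ℝ) : rightHalfPlane :=
  ⟨s + t * Complex.I, by simpa [rightHalfPlane] using s.2⟩

theorem verticalShift_coe (s : rightHalfPlane) (t : ℝ) :
    (verticalShift s t : ℂ) = s + t * Complex.I := rfl

theorem dist_verticalShift (s : rightHalfPlane) (t : ℝ) : dist (verticalShift s t) s = |t| := by
  simp [Subtype.dist_eq, dist_eq_norm, verticalShift_coe]

theorem continuous_verticalShift (s : rightHalfPlane) : Continuous (verticalShift s) := by
  unfold verticalShift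
  fun_prop

variable {f : rightHalfPlane → ℂ} {a : ℕ → ℂ} {μ : Measure ℝ}

theorem continuous_div_natCast_cpow_verticalShift (c : ℂ) {n : ℕ} (hn : n ≠ 0) (s : rightHalfPlane)
    (δ : ℝ) : Continuous fun τ : ℝ => c / (n : ℂ) ^ (verticalShift s (δ * τ) : ℂ) := by
  have hn0 : (n : ℂ) ≠ 0 := Nat.cast_ne_zero.2 hn
  refine continuous_const.div (Continuous.const_cpow ?_ (Or.inl hn0)) fun τ => ?_
  · exact continuous_subtype_val.comp ((continuous_verticalShift s).comp (continuous_const_mul δ))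
  · simp [Complex.cpow_eq_zero_iff, hn0]

theorem div_natCast_cpow_verticalShift (c : ℂ) {n : ℕ} (hn : n ≠ 0) (s : rightHalfPlane)
    (δ τ : ℝ) : c / (n : ℂ) ^ (verticalShift s (δ * τ) : ℂ) =
      c / (n : ℂ) ^ (s : ℂ) * Complex.exp ((-(δ * Real.log n) : ℝ) * τ * Complex.I) := by
  have hn0 : (n : ℂ) ≠ 0 := Nat.cast_ne_zero.2 hn
  rw [verticalShift_coe, Complex.cpow_add _ _ hn0, div_mul_eq_div_div,
    Complex.cpow_def_of_ne_zero hn0 (_ * Complex.I), div_eq_mul_inv _ (Complex.exp _),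
    ← Complex.exp_neg, ← Complex.natCast_log]
  congr 2
  push_cast
  ring

theorem integral_div_natCast_cpow_verticalShift (c : ℂ) {n : ℕ} (hn : n ≠ 0) (s : rightHalfPlane)
    (δ : ℝ) : ∫ τ, c / (n : ℂ) ^ (verticalShift s (δ * τ) : ℂ) ∂μ =
      c * charFun μ (-(δ * Real.log n)) / (n : ℂ) ^ (s : ℂ) := by
  simp only [div_natCast_cpow_verticalShift c hn, integral_const_mul, ← charFun_apply_real]
  ring

variable [IsProbabilityMeasure μ]

theorem exists_norm_verticalMean_sub_le (hf : UniformContinuous f)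
    (hμ : Integrable (fun τ : ℝ => |τ|) μ) {ε : ℝ} (hε : 0 < ε) :
    ∃ δ : ℝ, 0 < δ ∧ ∀ s, ‖(∫ τ, f (verticalShift s (δ * τ)) ∂μ) - f s‖ ≤ ε := by
  have hconvex : Convex ℝ rightHalfPlane := convex_halfSpace_re_gt 0
  obtain ⟨B, hB, hdist⟩ :=
    exists_dist_le_add_mul_dist_of_uniformContinuous hconvex hf (half_pos hε)
  set K : ℝ := ∫ τ, |τ| ∂μ
  have hBK : 0 ≤ B * K := mul_nonneg hB (integral_nonneg fun τ => abs_nonneg τ)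
  set δ : ℝ := ε / (2 * (B * K + 1))
  have hδ : 0 < δ := div_pos hε (by linarith)
  refine ⟨δ, hδ, fun s => ?_⟩
  have hbound : ∀ τ : ℝ,
      ‖f (verticalShift s (δ * τ)) - f s‖ ≤ ε / 2 + B * δ * |τ| := fun τ => by
    have h := hdist (verticalShift s (δ * τ)) s
    rwa [dist_verticalShift, abs_mul, abs_of_pos hδ, dist_eq_norm, ← mul_assoc] at h
  have hmajorant : Integrable (fun τ : ℝ => ε / 2 + B * δ * |τ|) μ :=
    (integrable_const _).add (hμ.const_mul _)
  have hdiff : Integrable (fun τ : ℝ => f (verticalShift s (δ * τ)) - f s) μ :=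
    hmajorant.mono' (((hf.continuous.comp ((continuous_verticalShift s).comp
      (continuous_const_mul δ))).sub continuous_const).aestronglyMeasurable) (.of_forall hbound)
  have hmean : (∫ τ, f (verticalShift s (δ * τ)) ∂μ) - f s =
      ∫ τ, (f (verticalShift s (δ * τ)) - f s) ∂μ := by
    have hint : Integrable (fun τ : ℝ => f (verticalShift s (δ * τ))) μ := by
      simpa only [Pi.add_def, sub_add_cancel] using hdiff.add (integrable_const (f s))
    simp only [integral_sub hint (integrable_const _), integral_const, probReal_univ, one_smul]
  calc ‖(∫ τ, f (verticalShift s (δ * τ)) ∂μ) - f s‖ ≤ ∫ τ, (ε / 2 + B * δ * |τ|) ∂μ :=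
        hmean ▸ norm_integral_le_of_norm_le hmajorant (.of_forall hbound)
    _ = ε / 2 + ε / 2 * (B * K / (B * K + 1)) := by
      rw [integral_add (integrable_const _) (hμ.const_mul _), integral_const_mul]
      simp only [integral_const, probReal_univ, one_smul, δ, K]
      field_simp
    _ ≤ ε / 2 + ε / 2 * 1 := by
      gcongr
      exact (div_le_one (by linarith)).2 (by linarith)
    _ = ε := by ring

theorem integrable_div_natCast_cpow_verticalShift (c : ℂ) {n : ℕ} (hn : n ≠ 0)
    (s : rightHalfPlane) (δ : ℝ) :
    Integrable (fun τ : ℝ => c / (n : ℂ) ^ (verticalShift s (δ * τ) : ℂ)) μ := by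
  refine .of_bound (continuous_div_natCast_cpow_verticalShift c hn s δ).aestronglyMeasurable
    ‖c / (n : ℂ) ^ (s : ℂ)‖ (.of_forall fun τ => ?_)
  rw [div_natCast_cpow_verticalShift c hn, norm_mul, ← Complex.ofReal_mul,
    Complex.norm_exp_ofReal_mul_I, mul_one]

theorem tendsto_sum_verticalMean
    (ha : ∀ s : rightHalfPlane,
      Tendsto (fun N : ℕ => ∑ n ∈ Finset.Icc 1 N, a n / (n : ℂ) ^ (s : ℂ)) atTop (𝓝 (f s)))
    (hμ : Integrable (fun τ : ℝ => |τ|) μ) (δ : ℝ) (s : rightHalfPlane) :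
    Tendsto (fun N : ℕ => ∑ n ∈ Finset.Icc 1 N,
        a n * charFun μ (-(δ * Real.log n)) / (n : ℂ) ^ (s : ℂ)) atTop
      (𝓝 (∫ τ, f (verticalShift s (δ * τ)) ∂μ)) := by
  have hne : ∀ {N n : ℕ}, n ∈ Finset.Icc 1 N → n ≠ 0 := fun hn =>
    Nat.one_le_iff_ne_zero.1 (Finset.mem_Icc.1 hn).1
  have hsum : ∀ N : ℕ, ∫ τ, ∑ n ∈ Finset.Icc 1 N, a n / (n : ℂ) ^ (verticalShift s (δ * τ) : ℂ) ∂μ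
      = ∑ n ∈ Finset.Icc 1 N, a n * charFun μ (-(δ * Real.log n)) / (n : ℂ) ^ (s : ℂ) := fun N => by
    rw [integral_finsetSum _ fun n hn =>
      integrable_div_natCast_cpow_verticalShift _ (hne hn) s δ]
    exact Finset.sum_congr rfl fun n hn => integral_div_natCast_cpow_verticalShift _ (hne hn) s δ
  have hs : 0 < (s : ℂ).re := s.2
  let w : rightHalfPlane := ⟨(s : ℂ) / 2, by simpa [rightHalfPlane] using hs⟩
  obtain ⟨C, hC, hle⟩ := exists_norm_sum_div_cpow_le (ha w) (half_pos hs)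
  refine (tendsto_integral_of_dominated_convergence
    (fun τ : ℝ => C * (1 + ‖(s : ℂ) / 2‖) + C * |δ| * |τ|) (fun N => ?_)
    ((integrable_const _).add (hμ.const_mul _)) (fun N => .of_forall fun τ => ?_)
    (.of_forall fun τ => ha (verticalShift s (δ * τ)))).congr hsum
  · exact (continuous_finsetSum _ fun n hn =>
      continuous_div_natCast_cpow_verticalShift _ (hne hn) s δ).aestronglyMeasurable
  · set z : ℂ := (s : ℂ) / 2 + (δ * τ : ℝ) * Complex.I
    have hwz : (verticalShift s (δ * τ) : ℂ) = w + z := by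
      simp only [verticalShift_coe, w, z]
      ring
    have hz : ‖z‖ ≤ ‖(s : ℂ) / 2‖ + |δ| * |τ| :=
      (norm_add_le _ _).trans_eq (by
        rw [norm_mul, Complex.norm_I, mul_one, Complex.norm_real, Real.norm_eq_abs, abs_mul])
    calc _ ≤ C * (1 + ‖z‖) := by
          rw [hwz]
          exact hle N z (by simp [z])
      _ ≤ C * (1 + (‖(s : ℂ) / 2‖ + |δ| * |τ|)) := by gcongr
      _ = _ := by ring

end VerticalMeans

section DirichletPolynomials

open MeasureTheory ProbabilityTheory

theorem integrable_abs_gaussianReal (m : ℝ) (v : NNReal) :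
    Integrable (fun τ : ℝ => |τ|) (gaussianReal m v) :=
  ((memLp_id_gaussianReal 1).integrable le_rfl).abs

theorem norm_charFun_gaussianReal (m : ℝ) (v : NNReal) (t : ℝ) :
    ‖charFun (gaussianReal m v) t‖ = Real.exp (-(v * t ^ 2 / 2)) := by
  rw [charFun_gaussianReal, Complex.norm_exp]
  congr 1
  simp [← Complex.ofReal_pow]

theorem summable_mul_exp_neg_mul_log_sq {c : ℝ} (hc : 0 < c) :
    Summable fun n : ℕ => (n : ℝ) * Real.exp (-(c * Real.log n ^ 2)) := by
  refine .of_norm_bounded_eventually_nat (Real.summable_nat_rpow.2 (by norm_num : (-2 : ℝ) < -1)) ?_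
  have hlog : Tendsto (fun n : ℕ => c * Real.log n) atTop atTop :=
    (Real.tendsto_log_atTop.comp tendsto_natCast_atTop_atTop).const_mul_atTop hc
  filter_upwards [hlog.eventually_ge_atTop 3, eventually_ge_atTop 1] with n hn hn1
  have hn0 : (0 : ℝ) < n := by exact_mod_cast hn1
  rw [Real.norm_of_nonneg (by positivity), Real.rpow_def_of_pos hn0]
  nth_rewrite 1 [← Real.exp_log hn0]
  rw [← Real.exp_add]
  exact Real.exp_le_exp.2 (by nlinarith [Real.log_natCast_nonneg n])

theorem div_natCast_zero_cpow (c : ℂ) (s : rightHalfPlane) : c / ((0 : ℕ) : ℂ) ^ (s : ℂ) = 0 := by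
  have hs : (s : ℂ) ≠ 0 := fun h => by simpa [rightHalfPlane, h] using s.2
  rw [Nat.cast_zero, Complex.zero_cpow hs, div_zero]

theorem norm_mul_charFun_gaussianReal_div_le {c : ℂ} {C : ℝ} {n : ℕ} (hn : n ≠ 0)
    (hc : ‖c‖ ≤ C * n) (δ : ℝ) (s : rightHalfPlane) :
    ‖c * charFun (gaussianReal 0 1) (-(δ * Real.log n)) / (n : ℂ) ^ (s : ℂ)‖ ≤
      C * (n * Real.exp (-(δ ^ 2 / 2 * Real.log n ^ 2))) := by
  rw [div_eq_mul_inv, ← Complex.cpow_neg, norm_mul]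
  refine (mul_le_of_le_one_right (norm_nonneg _)
    (norm_natCast_cpow_neg_le_one hn (le_of_lt s.2))).trans ?_
  rw [norm_mul, norm_charFun_gaussianReal, NNReal.coe_one, one_mul, neg_sq, mul_pow, ← mul_assoc,
    mul_div_right_comm]
  exact mul_le_mul_of_nonneg_right hc (Real.exp_pos _).le

theorem exists_dirichletPolynomial_close {f : rightHalfPlane → ℂ} (hf : f ∈ dirichletFunctions)
    {ε : ℝ} (hε : 0 < ε) : ∃ (c : ℕ → ℂ) (N : ℕ), ∀ s : rightHalfPlane,
      ‖∑ n ∈ Finset.range N, c n / (n : ℂ) ^ (s : ℂ) - f s‖ ≤ ε := by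
  obtain ⟨huc, a, ha⟩ := hf
  have hγ := integrable_abs_gaussianReal 0 1
  obtain ⟨δ, hδ, hmean⟩ := exists_norm_verticalMean_sub_le huc hγ (half_pos hε)
  obtain ⟨C, hC⟩ := exists_norm_coeff_le_mul_norm_cpow (ha ⟨1, by simp [rightHalfPlane]⟩)
  let c : ℕ → ℂ := fun n => a n * charFun (gaussianReal 0 1) (-(δ * Real.log n))
  have hsummable :=
    (summable_mul_exp_neg_mul_log_sq (show 0 < δ ^ 2 / 2 by positivity)).mul_left C
  have huniform := tendstoUniformly_tsum_nat
    (f := fun n (s : rightHalfPlane) => c n / (n : ℂ) ^ (s : ℂ)) hsummable fun n s => by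
      rcases eq_or_ne n 0 with rfl | hn
      · rw [div_natCast_zero_cpow]
        simp
      · refine norm_mul_charFun_gaussianReal_div_le hn ?_ δ s
        simpa only [Complex.cpow_one, Complex.norm_natCast] using hC n hn
  have htsum : ∀ s : rightHalfPlane, ∑' n, c n / (n : ℂ) ^ (s : ℂ) =
      ∫ τ, f (verticalShift s (δ * τ)) ∂gaussianReal 0 1 := fun s => by
    refine tendsto_nhds_unique ((huniform.tendsto_at s).comp (tendsto_add_atTop_nat 1))
      ((tendsto_sum_verticalMean ha hγ δ s).congr fun N => ?_)
    rw [Function.comp_apply, Finset.sum_range_eq_add_Ico _ N.succ_pos, div_natCast_zero_cpow,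
      zero_add]
    rfl
  obtain ⟨N, hN⟩ := (Metric.tendstoUniformly_iff.1 huniform (ε / 2) (half_pos hε)).exists
  refine ⟨c, N, fun s => (norm_sub_le_norm_sub_add_norm_sub _ (∑' n, c n / (n : ℂ) ^ (s : ℂ))
    _).trans ?_⟩
  rw [← add_halves ε, ← dist_eq_norm, dist_comm]
  exact add_le_add (hN s).le ((htsum s).symm ▸ hmean s)

theorem exists_polydiscAlgebra_comp_bohrPoint_eq_div (c : ℂ) (n : ℕ) :
    ∃ g ∈ polydiscAlgebra, ∀ s : rightHalfPlane, g (bohrPoint s) = c / (n : ℂ) ^ (s : ℂ) := by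
  rcases eq_or_ne n 0 with rfl | hn
  · exact ⟨0, zero_mem _, fun s => (div_natCast_zero_cpow c s).symm⟩
  refine ⟨c • (bohrExponent n).prod fun i k => coord i ^ k, polydiscAlgebra.smul_mem
    (prod_mem fun i _ => pow_mem (coord_mem_polydiscAlgebra i) _) c, fun s => ?_⟩
  have hprod := prod_bohrPoint_pow s (bohrExponent n)
  rw [bohrIndex_bohrExponent hn, Complex.cpow_neg] at hprod
  simpa only [ContinuousMap.smul_apply, smul_eq_mul, Finsupp.prod, ContinuousMap.prod_apply,
    ContinuousMap.pow_apply, coord_apply, div_eq_mul_inv] using congrArg (c * ·) hprod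

theorem exists_polydiscAlgebra_comp_bohrPoint_eq {f : rightHalfPlane → ℂ}
    (hf : f ∈ dirichletFunctions) : ∃ g ∈ polydiscAlgebra, g ∘ bohrPoint = f := by
  refine exists_comp_eq_of_forall_approx norm_le_norm_pullback_bohrPoint hf.1.continuous
    fun ε hε => ?_
  obtain ⟨c, N, hclose⟩ := exists_dirichletPolynomial_close hf hε
  choose g hg hgs using fun n => exists_polydiscAlgebra_comp_bohrPoint_eq_div (c n) n
  refine ⟨∑ n ∈ Finset.range N, g n, sum_mem fun n _ => hg n, fun s => ?_⟩
  simpa only [ContinuousMap.sum_apply, hgs] using hclose s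

end DirichletPolynomials

section Taylor

variable {V : Type*} [NormedAddCommGroup V] [NormedSpace ℂ V] {f : ℂ → V} {r C : ℝ}

/-- The `n`-th coefficient of the Taylor series of `f` at `0`. -/
noncomputable def taylorCoeff (f : ℂ → V) (n : ℕ) : V :=
  (n.factorial : ℂ)⁻¹ • iteratedDeriv n f 0

theorem taylorCoeff_zero (f : ℂ → V) : taylorCoeff f 0 = f 0 := by
  simp [taylorCoeff]

theorem taylorCoeff_one (f : ℂ → V) : taylorCoeff f 1 = deriv f 0 := by
  simp [taylorCoeff]

theorem iteratedDeriv_comp_mul_left (f : ℂ → V) (c : ℂ) (n : ℕ) :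
    iteratedDeriv n (fun w => f (c * w)) = fun w => c ^ n • iteratedDeriv n f (c * w) := by
  induction n with
  | zero => simp
  | succ n ih =>
    rw [iteratedDeriv_succ, ih, iteratedDeriv_succ]
    funext w
    rw [deriv_fun_const_smul_field, deriv_comp_mul_left, pow_succ, mul_smul]

theorem taylorCoeff_comp_mul_left (f : ℂ → V) (c : ℂ) (n : ℕ) :
    taylorCoeff (fun w => f (c * w)) n = c ^ n • taylorCoeff f n := by
  simp only [taylorCoeff, iteratedDeriv_comp_mul_left, mul_zero, smul_comm (c ^ n)]

variable [CompleteSpace V]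

theorem hasSum_taylorCoeff (hf : DifferentiableOn ℂ f (ball 0 r)) {w : ℂ}
    (hw : w ∈ ball (0 : ℂ) r) : HasSum (fun n => w ^ n • taylorCoeff f n) (f w) := by
  simpa only [taylorCoeff, sub_zero, smul_comm (w ^ _)] using
    Complex.hasSum_taylorSeries_on_ball hf hw

theorem norm_taylorCoeff_le (hr : 0 < r) (hf : DifferentiableOn ℂ f (ball 0 r))
    (hC : ∀ w ∈ ball (0 : ℂ) r, ‖f w‖ ≤ C) (n : ℕ) : ‖taylorCoeff f n‖ ≤ C / r ^ n := by
  have hcauchy : ∀ s ∈ Ioo 0 r, ‖taylorCoeff f n‖ ≤ C / s ^ n := fun s hs => by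
    have hsub : closedBall (0 : ℂ) s ⊆ ball 0 r := closedBall_subset_ball hs.2
    have hbound := Complex.norm_iteratedDeriv_le_of_forall_mem_sphere_norm_le n hs.1
      (hf.diffContOnCl_ball hsub) fun z hz => hC z (hsub (sphere_subset_closedBall hz))
    rwa [taylorCoeff, norm_smul, norm_inv, Complex.norm_natCast, inv_mul_le_iff₀ (by positivity),
      ← mul_div_assoc]
  have hlim : Tendsto (fun s : ℝ => C / s ^ n) (𝓝[<] r) (𝓝 (C / r ^ n)) :=
    ((continuousAt_const.div (continuousAt_id.pow n) (pow_pos hr n).ne').tendsto).mono_left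
      nhdsWithin_le_nhds
  exact ge_of_tendsto hlim (by filter_upwards [Ioo_mem_nhdsLT hr] using hcauchy)

theorem norm_sub_sum_taylorCoeff_le (hf : DifferentiableOn ℂ f (ball 0 r))
    (hC : ∀ w ∈ ball (0 : ℂ) r, ‖f w‖ ≤ C) {w : ℂ} (hw : w ∈ ball (0 : ℂ) r) (M : ℕ) :
    ‖f w - ∑ n ∈ Finset.range M, w ^ n • taylorCoeff f n‖ ≤
      C * (‖w‖ / r) ^ M / (1 - ‖w‖ / r) := by
  have hr : 0 < r := pos_of_mem_ball hw
  have hq : ‖w‖ / r < 1 := (div_lt_one hr).2 (mem_ball_zero_iff.1 hw)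
  rw [← ((hasSum_nat_add_iff' M).2 (hasSum_taylorCoeff hf hw)).tsum_eq, div_eq_mul_inv]
  refine tsum_of_norm_bounded
    ((hasSum_geometric_of_lt_one (by positivity) hq).mul_left (C * (‖w‖ / r) ^ M)) fun n => ?_
  calc ‖w ^ (n + M) • taylorCoeff f (n + M)‖ ≤ ‖w‖ ^ (n + M) * (C / r ^ (n + M)) := by
        rw [norm_smul, norm_pow]
        gcongr
        exact norm_taylorCoeff_le hr hf hC _
    _ = C * (‖w‖ / r) ^ M * (‖w‖ / r) ^ n := by
        rw [mul_assoc, ← pow_add, add_comm M, div_pow]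
        ring

theorem norm_sub_sum_taylorCoeff_le_two_mul (hf : DifferentiableOn ℂ f (ball 0 r))
    (hC : ∀ w ∈ ball (0 : ℂ) r, ‖f w‖ ≤ C) (hr : 0 < r) {w : ℂ} (hw : ‖w‖ ≤ r / 2) (M : ℕ) :
    ‖f w - ∑ n ∈ Finset.range M, w ^ n • taylorCoeff f n‖ ≤ 2 * C * (‖w‖ / r) ^ M := by
  have hC0 : 0 ≤ C := (norm_nonneg _).trans (hC 0 (mem_ball_self hr))
  have hq : ‖w‖ / r ≤ 1 / 2 := (div_le_iff₀ hr).2 (by linarith)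
  refine (norm_sub_sum_taylorCoeff_le hf hC (mem_ball_zero_iff.2 (by linarith)) M).trans ?_
  rw [div_le_iff₀ (by linarith)]
  nlinarith [mul_nonneg hC0 (pow_nonneg (div_nonneg (norm_nonneg w) hr.le) M)]

theorem norm_inv_pow_smul_sub_sum_taylorCoeff_le (hf : DifferentiableOn ℂ f (ball 0 r))
    (hC : ∀ w ∈ ball (0 : ℂ) r, ‖f w‖ ≤ C) {w : ℂ} (hw0 : w ≠ 0) (hw : ‖w‖ ≤ r / 2) (m k : ℕ) :
    ‖(w ^ m)⁻¹ • (f w - ∑ n ∈ Finset.range (m + k), w ^ n • taylorCoeff f n)‖ ≤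
      2 * C / r ^ (m + k) * ‖w‖ ^ k := by
  have hw0' : 0 < ‖w‖ := norm_pos_iff.2 hw0
  have hr : 0 < r := by linarith
  rw [norm_smul, norm_inv, norm_pow, inv_mul_le_iff₀ (by positivity)]
  calc _ ≤ _ := norm_sub_sum_taylorCoeff_le_two_mul hf hC hr hw (m + k)
    _ = ‖w‖ ^ m * (2 * C / r ^ (m + k) * ‖w‖ ^ k) := by
        rw [div_pow, pow_add ‖w‖]
        ring

theorem tendsto_inv_pow_smul_sub_sum_taylorCoeff (hr : 0 < r)
    (hf : DifferentiableOn ℂ f (ball 0 r)) (hC : ∀ w ∈ ball (0 : ℂ) r, ‖f w‖ ≤ C) (m : ℕ) :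
    Tendsto (fun w => (w ^ m)⁻¹ • (f w - ∑ n ∈ Finset.range m, w ^ n • taylorCoeff f n))
      (𝓝[≠] 0) (𝓝 (taylorCoeff f m)) := by
  rw [tendsto_iff_norm_sub_tendsto_zero]
  have hlim : Tendsto (fun w : ℂ => 2 * C / r ^ (m + 1) * ‖w‖ ^ 1) (𝓝[≠] 0) (𝓝 0) := by
    have : Continuous fun w : ℂ => 2 * C / r ^ (m + 1) * ‖w‖ ^ 1 := by fun_prop
    simpa using (this.tendsto 0).mono_left nhdsWithin_le_nhds
  refine squeeze_zero' (.of_forall fun _ => norm_nonneg _) ?_ hlim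
  filter_upwards [self_mem_nhdsWithin,
    nhdsWithin_le_nhds (ball_mem_nhds (0 : ℂ) (half_pos hr))] with w hw0 hw
  have hle := norm_inv_pow_smul_sub_sum_taylorCoeff_le hf hC hw0 (mem_ball_zero_iff.1 hw).le m 1
  rwa [Finset.sum_range_succ, ← sub_sub, smul_sub _ (f w - _), inv_smul_smul₀ (pow_ne_zero m hw0)]
    at hle

end Taylor

section BoundedConvergence

variable {ι V : Type*} [NormedAddCommGroup V] [NormedSpace ℂ V] {l : Filter ι} {C : ℝ}

theorem tendsto_deriv_of_tendsto_of_bounded [CompleteSpace V] [l.IsCountablyGenerated]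
    {f : ι → ℂ → V} {g : ℂ → V} {z : ℂ} {r : ℝ} (hr : 0 < r)
    (hf : ∀ᶠ n in l, DifferentiableOn ℂ (f n) (ball z r))
    (hC : ∀ᶠ n in l, ∀ w ∈ ball z r, ‖f n w‖ ≤ C)
    (hlim : ∀ w ∈ ball z r, Tendsto (fun n => f n w) l (𝓝 (g w))) :
    Tendsto (fun n => deriv (f n) z) l (𝓝 (Complex.cderiv (r / 2) g z)) := by
  have hsub : closedBall z (r / 2) ⊆ ball z r := closedBall_subset_ball (half_lt_self hr)
  have hmem : ∀ θ, circleMap z (r / 2) θ ∈ ball z r := fun θ =>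
    hsub (circleMap_mem_closedBall z (half_pos hr).le θ)
  have hne : ∀ θ, circleMap z (r / 2) θ - z ≠ 0 := fun θ =>
    sub_ne_zero.2 (circleMap_ne_center (half_pos hr).ne')
  have hkernel : Continuous fun θ =>
      deriv (circleMap z (r / 2)) θ * ((circleMap z (r / 2) θ - z) ^ 2)⁻¹ := by
    simp only [deriv_circleMap]
    exact (by fun_prop : Continuous _).mul
      ((((continuous_circleMap z _).sub continuous_const).pow 2).inv₀ fun θ =>
        pow_ne_zero 2 (hne θ))
  suffices h : Tendsto (fun n => Complex.cderiv (r / 2) (f n) z) l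
      (𝓝 (Complex.cderiv (r / 2) g z)) from
    h.congr' (hf.mono fun n hn => Complex.cderiv_eq_deriv isOpen_ball hn (half_pos hr) hsub)
  refine Tendsto.const_smul ?_ _
  simp only [circleIntegral, smul_smul]
  refine intervalIntegral.tendsto_integral_filter_of_dominated_convergence
    (fun θ => ‖deriv (circleMap z (r / 2)) θ * ((circleMap z (r / 2) θ - z) ^ 2)⁻¹‖ * C) ?_ ?_
    ((hkernel.norm.mul continuous_const).intervalIntegrable _ _)
    (.of_forall fun θ _ => (hlim _ (hmem θ)).const_smul _)
  · filter_upwards [hf] with n hn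
    exact (hkernel.smul (hn.continuousOn.comp_continuous (continuous_circleMap z _)
      hmem)).aestronglyMeasurable
  · filter_upwards [hC] with n hn
    refine .of_forall fun θ _ => ?_
    rw [norm_smul]
    gcongr
    exact hn _ (hmem θ)

variable {E : Type*} [NormedAddCommGroup E] [NormedSpace ℂ E] {x : E} {R : ℝ}

theorem mapsTo_add_smul_ball (x h : E) (R : ℝ) :
    MapsTo (fun w : ℂ => x + w • h) (ball 0 (R / ‖h‖)) (ball x R) := fun w hw => by
  have hw' : ‖w‖ < R / ‖h‖ := mem_ball_zero_iff.1 hw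
  rcases (norm_nonneg h).eq_or_lt with h0 | h0
  · rw [← h0, div_zero] at hw'
    exact absurd hw' (norm_nonneg w).not_gt
  · rwa [mem_ball_iff_norm, add_sub_cancel_left, norm_smul, ← lt_div_iff₀ h0]

theorem deriv_comp_add_smul {F : E → V} (hF : DifferentiableAt ℂ F x) (h : E) :
    deriv (fun w : ℂ => F (x + w • h)) 0 = fderiv ℂ F x h :=
  hF.lineDeriv_eq_fderiv

theorem norm_fderiv_le_of_bounded {F : E → V} (hR : 0 < R)
    (hF : DifferentiableOn ℂ F (ball x R)) (hC : ∀ y ∈ ball x R, ‖F y‖ ≤ C) :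
    ‖fderiv ℂ F x‖ ≤ 2 * C / R :=
  Complex.norm_fderiv_le_div_of_mapsTo_ball hF (fun y hy => mem_closedBall_iff_norm.2 <|
    (norm_sub_le _ _).trans (by linarith [hC y hy, hC x (mem_ball_self hR)])) hR

variable [CompleteSpace V]

theorem norm_sub_sub_fderiv_le_of_bounded {F : E → V} (hR : 0 < R)
    (hF : DifferentiableOn ℂ F (ball x R)) (hC : ∀ y ∈ ball x R, ‖F y‖ ≤ C) {h : E}
    (hh : ‖h‖ ≤ R / 2) : ‖F (x + h) - F x - fderiv ℂ F x h‖ ≤ 2 * C / R ^ 2 * ‖h‖ ^ 2 := by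
  rcases eq_or_ne h 0 with rfl | hne
  · simp
  have hh0 : 0 < ‖h‖ := norm_pos_iff.2 hne
  have hmaps := mapsTo_add_smul_ball x h R
  have hle := norm_sub_sum_taylorCoeff_le_two_mul
    (hF.comp (by fun_prop : DifferentiableOn ℂ (fun w : ℂ => x + w • h) _) hmaps)
    (fun w hw => hC _ (hmaps hw)) (div_pos hR hh0) (w := 1)
    (by rw [norm_one, div_div, le_div_iff₀ (by positivity)]; linarith) 2
  simp only [Finset.sum_range_succ, Finset.sum_range_zero, one_pow, one_smul, zero_add, norm_one,
    taylorCoeff_zero, taylorCoeff_one, Function.comp_apply, zero_smul, add_zero, ← sub_sub,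
    one_div_div] at hle
  rw [← deriv_comp_add_smul (hF.differentiableAt (ball_mem_nhds x hR))]
  exact hle.trans_eq (by rw [div_pow]; ring)

variable [l.NeBot] [l.IsCountablyGenerated]

theorem exists_tendsto_fderiv_of_bounded {F : ι → E → V} {G : E → V} (hR : 0 < R)
    (hF : ∀ᶠ n in l, DifferentiableOn ℂ (F n) (ball x R))
    (hC : ∀ᶠ n in l, ∀ y ∈ ball x R, ‖F n y‖ ≤ C)
    (hlim : ∀ y ∈ ball x R, Tendsto (fun n => F n y) l (𝓝 (G y))) :
    ∃ L : E →L[ℂ] V, ∀ h, Tendsto (fun n => fderiv ℂ (F n) x h) l (𝓝 (L h)) := by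
  have hexists : ∀ h : E, ∃ a : V, Tendsto (fun n => fderiv ℂ (F n) x h) l (𝓝 a) := fun h => by
    rcases eq_or_ne h 0 with rfl | hne
    · exact ⟨0, by simpa only [map_zero] using tendsto_const_nhds⟩
    have hmaps := mapsTo_add_smul_ball x h R
    refine ⟨_, (tendsto_deriv_of_tendsto_of_bounded (g := fun w => G (x + w • h))
      (f := fun n w => F n (x + w • h)) (div_pos hR (norm_pos_iff.2 hne))
      (hF.mono fun n hn => hn.comp (by fun_prop) hmaps)
      (hC.mono fun n hn w hw => hn _ (hmaps hw)) fun w hw => hlim _ (hmaps hw)).congr' ?_⟩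
    filter_upwards [hF] with n hn
    exact deriv_comp_add_smul (hn.differentiableAt (ball_mem_nhds x hR)) h
  choose a ha using hexists
  refine ⟨(linearMapOfTendsto a (fun n => (fderiv ℂ (F n) x : E →ₗ[ℂ] V))
    (tendsto_pi_nhds.2 ha)).mkContinuous (2 * C / R) fun h => le_of_tendsto (ha h).norm ?_, ha⟩
  filter_upwards [hF, hC] with n hFn hCn
  exact (fderiv ℂ (F n) x).le_of_opNorm_le (norm_fderiv_le_of_bounded hR hFn hCn) h

theorem differentiableAt_of_tendsto_of_bounded {F : ι → E → V} {G : E → V} (hR : 0 < R)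
    (hF : ∀ᶠ n in l, DifferentiableOn ℂ (F n) (ball x R))
    (hC : ∀ᶠ n in l, ∀ y ∈ ball x R, ‖F n y‖ ≤ C)
    (hlim : ∀ y ∈ ball x R, Tendsto (fun n => F n y) l (𝓝 (G y))) : DifferentiableAt ℂ G x := by
  obtain ⟨L, hL⟩ := exists_tendsto_fderiv_of_bounded hR hF hC hlim
  suffices h : (fun h : E => G (x + h) - G x - L h) =O[𝓝 0] fun h : E => ‖h‖ ^ 2 from
    (hasFDerivAt_iff_isLittleO_nhds_zero.2
      (h.trans_isLittleO (Asymptotics.isLittleO_norm_pow_id one_lt_two))).differentiableAt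
  refine .of_bound (2 * C / R ^ 2) ?_
  filter_upwards [ball_mem_nhds (0 : E) (half_pos hR)] with h hh
  have hh' : ‖h‖ < R / 2 := mem_ball_zero_iff.1 hh
  have hxh : x + h ∈ ball x R := by
    rw [mem_ball_iff_norm, add_sub_cancel_left]
    linarith
  rw [norm_pow, norm_norm]
  refine le_of_tendsto (((hlim _ hxh).sub (hlim _ (mem_ball_self hR))).sub (hL h)).norm ?_
  filter_upwards [hF, hC] with n hFn hCn
  exact norm_sub_sub_fderiv_le_of_bounded hR hFn hCn hh'.le

end BoundedConvergence

section HomogeneousParts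

variable {E V : Type*} [NormedAddCommGroup E] [NormedSpace ℂ E] [NormedAddCommGroup V]
  [NormedSpace ℂ V]

/-- Entire functions between complex normed spaces that are homogeneous of degree `m`. By Taylor
expansion at `0` these are exactly the continuous `m`-homogeneous polynomials. -/
structure IsHomogeneousPolynomial (m : ℕ) (P : E → V) : Prop where
  differentiable : Differentiable ℂ P
  map_smul : ∀ (c : ℂ) (x : E), P (c • x) = c ^ m • P x

/-- The component of degree `m` in the expansion of `F` at `0` into homogeneous polynomials, defined
along each complex line through `0` by the Taylor coefficient of degree `m`. -/
noncomputable def homogeneousPart (F : E → V) (m : ℕ) (x : E) : V :=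
  taylorCoeff (fun w : ℂ => F (w • x)) m

theorem homogeneousPart_smul (F : E → V) (m : ℕ) (c : ℂ) (x : E) :
    homogeneousPart F m (c • x) = c ^ m • homogeneousPart F m x := by
  simp only [homogeneousPart, smul_smul, ← taylorCoeff_comp_mul_left, mul_comm c]

theorem mapsTo_smul_ball {x : E} {K : ℝ} (hK : 0 < K) (hx : ‖x‖ ≤ K) (R : ℝ) :
    MapsTo (fun w : ℂ => w • x) (ball 0 (R / K)) (ball 0 R) := fun w hw => by
  rw [mem_ball_zero_iff, lt_div_iff₀ hK] at hw
  rw [mem_ball_zero_iff, norm_smul]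
  exact (mul_le_mul_of_nonneg_left hx (norm_nonneg w)).trans_lt hw

theorem exists_norm_fderiv_le {F : E → V} (hF : Differentiable ℂ F) (x : E) :
    ∃ R > 0, ∃ C, ∀ y ∈ ball x R, ‖fderiv ℂ F y‖ ≤ C := by
  obtain ⟨R, hR, hdist⟩ := Metric.continuousAt_iff.1 hF.continuous.continuousAt 1 one_pos
  refine ⟨R / 2, half_pos hR, 2 * (‖F x‖ + 1) / (R / 2), fun y hy =>
    norm_fderiv_le_of_bounded (half_pos hR) hF.differentiableOn fun z hz => ?_⟩
  have hzx : dist z x < R := by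
    linarith [dist_triangle z y x, mem_ball.1 hz, mem_ball.1 hy]
  linarith [norm_le_norm_add_norm_sub' (F z) (F x), dist_eq_norm (F z) (F x), hdist hzx]

theorem IsHomogeneousPolynomial.fderiv_smul_of_ne_zero {F : E → V} {m : ℕ}
    (hF : IsHomogeneousPolynomial (m + 1) F) {c : ℂ} (hc : c ≠ 0) (x v : E) :
    fderiv ℂ F (c • x) v = c ^ m • fderiv ℂ F x v := by
  have h : fderiv ℂ (fun y => F (c • y)) x v = fderiv ℂ (fun y => c ^ (m + 1) • F y) x v := by
    simp only [hF.map_smul]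
  rw [fderiv_comp_smul, fderiv_fun_const_smul (hF.differentiable x), pow_succ', mul_smul] at h
  exact smul_right_injective V hc h

variable [CompleteSpace V] {F : E → V} {R C : ℝ}

theorem norm_sub_sum_homogeneousPart_le (hF : DifferentiableOn ℂ F (ball 0 R))
    (hC : ∀ y ∈ ball (0 : E) R, ‖F y‖ ≤ C) (hR : 0 < R) {x : E} (hx : ‖x‖ ≤ R) {w : ℂ}
    (hw : ‖w‖ < 1) (M : ℕ) :
    ‖F (w • x) - ∑ m ∈ Finset.range M, w ^ m • homogeneousPart F m x‖ ≤
      C * ‖w‖ ^ M / (1 - ‖w‖) := by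
  have hmaps := mapsTo_smul_ball hR hx R
  rw [div_self hR.ne'] at hmaps
  simpa only [homogeneousPart, Function.comp_def, div_one] using norm_sub_sum_taylorCoeff_le
    (hF.comp (by fun_prop : DifferentiableOn ℂ (fun w : ℂ => w • x) _) hmaps)
    (fun v hv => hC _ (hmaps hv)) (mem_ball_zero_iff.2 hw) M

/-- Inductively, the part of degree `m` is the limit of `t⁻ᵐ (F (t y) - ∑ n < m, tⁿ Fₙ y)` as
`t → 0`, boundedly on bounded sets. -/
theorem differentiable_homogeneousPart (hF : DifferentiableOn ℂ F (ball 0 R))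
    (hC : ∀ y ∈ ball (0 : E) R, ‖F y‖ ≤ C) (hR : 0 < R) (m : ℕ) :
    Differentiable ℂ (homogeneousPart F m) := by
  induction m using Nat.strong_induction_on with
  | _ m ih =>
    intro x
    set K : ℝ := ‖x‖ + 1
    have hK : 0 < K := by positivity
    have hnorm : ∀ y ∈ ball x 1, ‖y‖ ≤ K := fun y hy => (norm_lt_of_mem_ball hy).le
    have hmaps := fun (y : E) hy => mapsTo_smul_ball hK (hnorm y hy) R
    have hdiff : ∀ y ∈ ball x 1, DifferentiableOn ℂ (fun w : ℂ => F (w • y)) (ball 0 (R / K)) :=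
      fun y hy => hF.comp (differentiable_id.smul_const y).differentiableOn (hmaps y hy)
    have hbound : ∀ y ∈ ball x 1, ∀ w ∈ ball (0 : ℂ) (R / K), ‖F (w • y)‖ ≤ C :=
      fun y hy w hw => hC _ (hmaps y hy hw)
    have hsmall := nhdsWithin_le_nhds (s := {0}ᶜ)
      (ball_mem_nhds (0 : ℂ) (half_pos (div_pos hR hK)))
    refine differentiableAt_of_tendsto_of_bounded (l := 𝓝[≠] (0 : ℂ)) (x := x) zero_lt_one
      (F := fun t y =>
        (t ^ m)⁻¹ • (F (t • y) - ∑ n ∈ Finset.range m, t ^ n • homogeneousPart F n y))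
      (C := 2 * C / (R / K) ^ m) ?_ ?_ fun y hy =>
      tendsto_inv_pow_smul_sub_sum_taylorCoeff (div_pos hR hK) (hdiff y hy) (hbound y hy) m
    · filter_upwards [hsmall] with t ht
      have hFt : DifferentiableOn ℂ (fun y => F (t • y)) (ball x 1) :=
        hF.comp (differentiable_id.const_smul t).differentiableOn fun y hy => hmaps y hy
          (ball_subset_ball (half_le_self (div_pos hR hK).le) ht)
      refine (hFt.sub (DifferentiableOn.fun_sum fun n hn => ?_)).const_smul _
      exact ((ih n (Finset.mem_range.1 hn)).const_smul _).differentiableOn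
    · filter_upwards [hsmall, self_mem_nhdsWithin] with t ht ht0 y hy
      simpa only [homogeneousPart, add_zero, pow_zero, mul_one] using
        norm_inv_pow_smul_sub_sum_taylorCoeff_le
          (hdiff y hy) (hbound y hy) ht0 (mem_ball_zero_iff.1 ht).le m 0

theorem isHomogeneousPolynomial_homogeneousPart (hF : DifferentiableOn ℂ F (ball 0 R))
    (hC : ∀ y ∈ ball (0 : E) R, ‖F y‖ ≤ C) (hR : 0 < R) (m : ℕ) :
    IsHomogeneousPolynomial m (homogeneousPart F m) :=
  ⟨differentiable_homogeneousPart hF hC hR m, homogeneousPart_smul F m⟩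

theorem differentiable_fderiv_apply (hF : Differentiable ℂ F) (v : E) :
    Differentiable ℂ fun x => fderiv ℂ F x v := by
  intro x
  obtain ⟨R, hR, C, hC⟩ := exists_norm_fderiv_le hF x
  refine differentiableAt_of_tendsto_of_bounded (l := 𝓝[≠] (0 : ℂ)) (half_pos hR)
    (F := fun t y => t⁻¹ • (F (y + t • v) - F y)) (C := C * ‖v‖) (.of_forall fun t => ?_) ?_
    fun y _ => ((hF y).hasFDerivAt.hasLineDerivAt v).tendsto_slope_zero
  · exact (((hF.comp (by fun_prop : Differentiable ℂ fun y => y + t • v)).sub hF).const_smul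
      _).differentiableOn
  · have hsmall : ∀ᶠ t in 𝓝[≠] (0 : ℂ), ‖t • v‖ < R / 2 :=
      nhdsWithin_le_nhds (((by fun_prop : Continuous fun t : ℂ => ‖t • v‖).tendsto' 0 0
        (by simp)).eventually_lt_const (half_pos hR))
    filter_upwards [hsmall, self_mem_nhdsWithin] with t ht ht0 y hy
    have hy' : y ∈ ball x R := ball_subset_ball (half_le_self hR.le) hy
    have hyt : y + t • v ∈ ball x R := mem_ball.2 <| (dist_triangle _ y x).trans_lt <| by
      rw [dist_self_add_left]
      linarith [mem_ball.1 hy]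
    have hle := (convex_ball x R).norm_image_sub_le_of_norm_fderiv_le (𝕜 := ℂ)
      (fun z _ => hF z) hC hy' hyt
    rw [add_sub_cancel_left, norm_smul] at hle
    rwa [norm_smul, norm_inv, inv_mul_le_iff₀ (norm_pos_iff.2 ht0), mul_left_comm]

theorem IsHomogeneousPolynomial.fderiv_smul {m : ℕ} (hF : IsHomogeneousPolynomial (m + 1) F)
    (c : ℂ) (x v : E) : fderiv ℂ F (c • x) v = c ^ m • fderiv ℂ F x v := by
  have hcont := (differentiable_fderiv_apply hF.differentiable v).continuous
  exact congrFun (Continuous.ext_on (dense_compl_singleton (0 : ℂ))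
    (hcont.comp (by fun_prop : Continuous fun c : ℂ => c • x)) (by fun_prop)
    fun c hc => hF.fderiv_smul_of_ne_zero hc x v) c

end HomogeneousParts

section NullSequences

theorem norm_apply_le_norm_c0 (x : C₀(ℕ, ℂ)) (i : ℕ) : ‖x i‖ ≤ ‖x‖ :=
  x.toBCF.norm_coe_le_norm i

theorem norm_le_of_forall_c0 {x : C₀(ℕ, ℂ)} {r : ℝ} (hr : 0 ≤ r) (h : ∀ i, ‖x i‖ ≤ r) :
    ‖x‖ ≤ r := by
  rw [← ZeroAtInftyContinuousMap.norm_toBCF_eq_norm]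
  exact (BoundedContinuousFunction.norm_le hr).2 h

/-- The `i`-th coordinate functional on `c₀`. -/
noncomputable def evalC0 (i : ℕ) : C₀(ℕ, ℂ) →L[ℂ] ℂ :=
  LinearMap.mkContinuous ⟨⟨fun x => x i, fun _ _ => rfl⟩, fun _ _ => rfl⟩ 1 fun x =>
    (norm_apply_le_norm_c0 x i).trans_eq (one_mul _).symm

@[simp] theorem evalC0_apply (i : ℕ) (x : C₀(ℕ, ℂ)) : evalC0 i x = x i := rfl

/-- The `i`-th vector of the standard basis of `c₀`. -/
noncomputable def unitVector (i : ℕ) : C₀(ℕ, ℂ) where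
  toFun j := if j = i then 1 else 0
  continuous_toFun := continuous_of_discreteTopology
  zero_at_infty' := by
    rw [cocompact_eq_cofinite]
    refine tendsto_const_nhds.congr' ?_
    filter_upwards [(finite_singleton i).compl_mem_cofinite] with j hj
    exact (if_neg hj).symm

theorem unitVector_apply (i j : ℕ) : unitVector i j = if j = i then 1 else 0 := rfl

/-- The sequence `(z₀, …, z_{N-1}, 0, 0, …)`, as an element of `c₀`. -/
noncomputable def headC0 (N : ℕ) (z : ℕ → ℂ) : C₀(ℕ, ℂ) :=
  ∑ i ∈ Finset.range N, z i • unitVector i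

theorem headC0_apply (N : ℕ) (z : ℕ → ℂ) (i : ℕ) : headC0 N z i = if i < N then z i else 0 := by
  rw [headC0, ← evalC0_apply, map_sum]
  simp [unitVector_apply]

theorem norm_headC0_le (N : ℕ) {z : ℕ → ℂ} {r : ℝ} (hr : 0 ≤ r) (hz : ∀ i, ‖z i‖ ≤ r) :
    ‖headC0 N z‖ ≤ r := by
  refine norm_le_of_forall_c0 hr fun i => ?_
  rw [headC0_apply]
  split_ifs
  · exact hz i
  · rwa [norm_zero]

theorem continuous_headC0 (N : ℕ) : Continuous (headC0 N) := by
  unfold headC0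
  fun_prop

theorem differentiable_headC0_update (N : ℕ) (z : ℕ → ℂ) (i : ℕ) :
    Differentiable ℂ fun w => headC0 N (Function.update z i w) := by
  refine Differentiable.fun_sum fun j _ => Differentiable.smul_const ?_ _
  by_cases h : j = i
  · subst h
    simp only [Function.update_self]
    exact differentiable_id
  · simp only [Function.update_of_ne h]
    exact differentiable_const _

theorem tendsto_headC0 (x : C₀(ℕ, ℂ)) : Tendsto (fun N => headC0 N x) atTop (𝓝 x) := by
  refine Metric.tendsto_atTop.2 fun ε hε => ?_
  have hx : Tendsto x atTop (𝓝 0) := by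
    simpa only [cocompact_eq_cofinite, Nat.cofinite_eq_atTop] using zero_at_infty x
  obtain ⟨N, hN⟩ := Metric.tendsto_atTop.1 hx (ε / 2) (half_pos hε)
  refine ⟨N, fun M hM => lt_of_le_of_lt ?_ (half_lt_self hε)⟩
  rw [dist_eq_norm]
  refine norm_le_of_forall_c0 (half_pos hε).le fun i => ?_
  rw [ZeroAtInftyContinuousMap.sub_apply, headC0_apply]
  split_ifs with hi
  · simpa using (half_pos hε).le
  · simpa using (hN i (hM.trans (not_lt.1 hi))).le

end NullSequences

section UnitBall

theorem norm_lt_one_of_mem_unitBallC0 {x : C₀(ℕ, ℂ)} (hx : x ∈ unitBallC0) : ‖x‖ < 1 :=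
  mem_ball_zero_iff.1 hx

/-- The inclusion of the unit ball of `c₀` in the closed polydisc. -/
noncomputable def ballPoint : C(unitBallC0, ClosedPolydisc) where
  toFun x i := ⟨x.1 i, mem_closedBall_zero_iff.2
    ((norm_apply_le_norm_c0 _ i).trans (norm_lt_one_of_mem_unitBallC0 x.2).le)⟩
  continuous_toFun := continuous_pi fun i =>
    ((evalC0 i).continuous.comp continuous_subtype_val).subtype_mk _

@[simp] theorem ballPoint_apply (x : unitBallC0) (i : ℕ) : (ballPoint x i : ℂ) = x.1 i := rfl

theorem uniformContinuous_ballPoint : UniformContinuous ballPoint :=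
  uniformContinuous_pi.2 fun i =>
    ((evalC0 i).uniformContinuous.comp uniformContinuous_subtype_val).subtype_mk _

theorem denseRange_ballPoint : DenseRange ballPoint := by
  intro z
  let t : ℕ → ℝ := fun n => 1 - 1 / (n + 1)
  have ht0 : ∀ n, 0 ≤ t n := fun n =>
    sub_nonneg.2 (div_le_one_of_le₀ (by linarith [n.cast_nonneg (α := ℝ)]) (by positivity))
  have ht1 : ∀ n, t n < 1 := fun n => sub_lt_self _ Nat.one_div_pos_of_nat
  have hball : ∀ n, headC0 n (fun i => t n * z i) ∈ unitBallC0 := fun n =>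
    mem_ball_zero_iff.2 ((norm_headC0_le n (ht0 n) fun i => by
      rw [norm_mul, Complex.norm_real, Real.norm_of_nonneg (ht0 n)]
      exact mul_le_of_le_one_right (ht0 n) (mem_closedBall_zero_iff.1 (z i).2)).trans_lt (ht1 n))
  have hlim : Tendsto (fun n => (t n : ℂ)) atTop (𝓝 1) := by
    simpa [t] using (tendsto_one_div_add_atTop_nhds_zero_nat (𝕜 := ℂ)).const_sub 1
  refine mem_closure_of_tendsto (b := atTop) (f := fun n => ballPoint ⟨_, hball n⟩)
    (tendsto_pi_nhds.2 fun i => tendsto_subtype_rng.2 ?_) (.of_forall fun n => mem_range_self _)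
  have hcoord := hlim.mul_const (z i : ℂ)
  rw [one_mul] at hcoord
  refine hcoord.congr' ?_
  filter_upwards [eventually_gt_atTop i] with n hn
  rw [ballPoint_apply, headC0_apply, if_pos hn]

theorem differentiable_eval_c0 (Q : MvPolynomial ℕ ℂ) :
    Differentiable ℂ fun x : C₀(ℕ, ℂ) => MvPolynomial.eval x Q := by
  induction Q using MvPolynomial.induction_on with
  | C a => simp
  | add p q hp hq =>
    simp only [map_add]
    exact hp.fun_add hq
  | mul_X p i hp =>
    simp only [map_mul, MvPolynomial.eval_X]
    exact hp.fun_mul (evalC0 i).differentiable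

theorem aeval_coord_ballPoint (Q : MvPolynomial ℕ ℂ) (x : unitBallC0) :
    MvPolynomial.aeval coord Q (ballPoint x) = MvPolynomial.eval x.1 Q := by
  rw [aeval_coord_apply, MvPolynomial.eval_eq]
  rfl

theorem comp_ballPoint_mem_ballFunctions {g : C(ClosedPolydisc, ℂ)} (hg : g ∈ polydiscAlgebra) :
    g ∘ ballPoint ∈ ballFunctions := by
  let F : C₀(ℕ, ℂ) → ℂ := Function.extend Subtype.val (g ∘ ballPoint) 0
  have hF : ∀ x : unitBallC0, F x = g (ballPoint x) := Subtype.val_injective.extend_apply _ _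
  refine ⟨(CompactSpace.uniformContinuous_of_continuous g.continuous).comp
    uniformContinuous_ballPoint, F, fun x hx => ?_, fun x => (hF x).symm⟩
  obtain ⟨Q, hQ⟩ := exists_tendsto_aeval_coord hg
  obtain ⟨C, hC⟩ := hQ.norm.bddAbove_range
  obtain ⟨R, hR, hsub⟩ := Metric.isOpen_iff.1 isOpen_ball x hx
  refine (differentiableAt_of_tendsto_of_bounded (l := atTop) hR
    (.of_forall fun k => (differentiable_eval_c0 (Q k)).differentiableOn) (C := C)
    (.of_forall fun k y hy => ?_) fun y hy => ?_).differentiableWithinAt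
  · rw [← aeval_coord_ballPoint (Q k) ⟨y, hsub hy⟩]
    exact (ContinuousMap.norm_coe_le_norm _ _).trans (hC (mem_range_self k))
  · let y' : unitBallC0 := ⟨y, hsub hy⟩
    rw [show F y = g (ballPoint y') from hF y']
    exact (((continuous_eval_const (ballPoint y')).tendsto g).comp hQ).congr fun k =>
      aeval_coord_ballPoint (Q k) y'

end UnitBall

section Schur

theorem exists_isOpen_forall_dist_le_of_cauchySeq {X Y : Type*} [TopologicalSpace X] [BaireSpace X]
    [Nonempty X] [PseudoMetricSpace Y] {σ : ℕ → X → Y} (hσ : ∀ k, Continuous (σ k))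
    (h : ∀ x, CauchySeq fun k => σ k x) {ε : ℝ} (hε : 0 < ε) :
    ∃ n, ∃ U : Set X, IsOpen U ∧ U.Nonempty ∧ ∀ x ∈ U, ∀ k ≥ n, dist (σ k x) (σ n x) ≤ ε := by
  have hclosed : ∀ n, IsClosed {x | ∀ k ≥ n, dist (σ k x) (σ n x) ≤ ε} := fun n => by
    simp only [ofPred_forall]
    exact isClosed_iInter fun k => isClosed_iInter fun _ =>
      isClosed_le ((hσ k).dist (hσ n)) continuous_const
  have hcover : ⋃ n, {x | ∀ k ≥ n, dist (σ k x) (σ n x) ≤ ε} = univ :=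
    eq_univ_of_forall fun x => by
      obtain ⟨n, hn⟩ := Metric.cauchySeq_iff'.1 (h x) ε hε
      exact mem_iUnion.2 ⟨n, fun k hk => (hn k hk).le⟩
  obtain ⟨n, hn⟩ := nonempty_interior_of_iUnion_of_closed hclosed hcover
  exact ⟨n, _, isOpen_interior, hn, fun x hx => interior_subset hx⟩

variable {ι V : Type*} [NormedAddCommGroup V]

/-- The sum of `b` over the index set with characteristic function `S`. As a function of `S` it
lives on the Cantor space, to which Baire's theorem applies. -/
noncomputable def subsum (b : ι → V) (S : ι → Bool) : V :=
  ∑' j, if S j then b j else 0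

theorem norm_subsum_term_le (b : ι → V) (S : ι → Bool) (j : ι) :
    ‖if S j then b j else 0‖ ≤ ‖b j‖ := by
  split_ifs
  · exact le_rfl
  · exact norm_zero.trans_le (norm_nonneg _)

variable [CompleteSpace V] {b : ι → V}

theorem summable_subsum (hb : Summable fun j => ‖b j‖) (S : ι → Bool) :
    Summable fun j => if S j then b j else 0 :=
  .of_norm_bounded hb (norm_subsum_term_le b S)

theorem continuous_subsum (hb : Summable fun j => ‖b j‖) : Continuous (subsum b) :=
  continuous_tsum (fun j => (continuous_of_discreteTopology
    (f := fun s : Bool => if s then b j else 0)).comp (continuous_apply j)) hb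
    fun j S => norm_subsum_term_le b S j

theorem subsum_update_true_sub_subsum_update_false [DecidableEq ι] (hb : Summable fun j => ‖b j‖)
    (S : ι → Bool) (i : ι) :
    subsum b (Function.update S i true) - subsum b (Function.update S i false) = b i := by
  rw [subsum, subsum, ← (summable_subsum hb _).tsum_sub (summable_subsum hb _), tsum_eq_single i]
  · simp
  · intro j hj
    simp [hj]

theorem tendsto_update_atTop {β : Type*} [TopologicalSpace β] (S : ℕ → β) (c : β) :
    Tendsto (fun k => Function.update S k c) atTop (𝓝 S) := by
  refine tendsto_pi_nhds.2 fun j => tendsto_const_nhds.congr' ?_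
  filter_upwards [eventually_gt_atTop j] with k hk
  exact (Function.update_of_ne hk.ne _ _).symm

/-- On an open set of `S` the subsums of `b k` are within `ε / 4` of those of a fixed row `b n`.
That set allows the entry `k` of `S` to be switched if `k` is large, so `b k k` is close to
`b n k`. -/
theorem tendsto_diagonal_zero_of_cauchySeq_subsum {b : ℕ → ℕ → V}
    (hb : ∀ k, Summable fun j => ‖b k j‖) (h : ∀ S, CauchySeq fun k => subsum (b k) S) :
    Tendsto (fun k => b k k) atTop (𝓝 0) := by
  refine Metric.tendsto_nhds.2 fun ε hε => ?_
  obtain ⟨n, U, hU, ⟨S, hS⟩, hclose⟩ := exists_isOpen_forall_dist_le_of_cauchySeq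
    (fun k => continuous_subsum (hb k)) h (show 0 < ε / 4 by positivity)
  have hmem : ∀ c : Bool, ∀ᶠ k in atTop, Function.update S k c ∈ U := fun c =>
    (tendsto_update_atTop S c).eventually (hU.mem_nhds hS)
  have hrow : ∀ᶠ k in atTop, ‖b n k‖ < ε / 4 :=
    (hb n).tendsto_atTop_zero.eventually_lt_const (by positivity)
  filter_upwards [hmem true, hmem false, hrow, eventually_ge_atTop n] with k htrue hfalse hbk hk
  have hsplit : b k k - b n k =
      (subsum (b k) (Function.update S k true) - subsum (b n) (Function.update S k true)) -
        (subsum (b k) (Function.update S k false) - subsum (b n) (Function.update S k false)) := by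
    rw [← subsum_update_true_sub_subsum_update_false (hb k) S k,
      ← subsum_update_true_sub_subsum_update_false (hb n) S k]
    abel
  have hbound : ‖b k k - b n k‖ ≤ ε / 4 + ε / 4 := by
    rw [hsplit]
    refine (norm_sub_le _ _).trans (add_le_add ?_ ?_) <;> rw [← dist_eq_norm]
    exacts [hclose _ htrue k hk, hclose _ hfalse k hk]
  rw [dist_zero_right]
  linarith [norm_le_norm_add_norm_sub' (b k k) (b n k)]

end Schur

section DisjointSupports

variable {ι : Type*} {v : ι → C₀(ℕ, ℂ)}

theorem norm_sum_smul_le_of_disjoint (hv : ∀ k, ‖v k‖ ≤ 1)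
    (hd : Pairwise fun j k => Disjoint (Function.support (v j)) (Function.support (v k)))
    (s : Finset ι) {θ : ι → ℂ} (hθ : ∀ k, ‖θ k‖ ≤ 1) : ‖∑ k ∈ s, θ k • v k‖ ≤ 1 := by
  refine norm_le_of_forall_c0 zero_le_one fun i => ?_
  rw [← evalC0_apply, map_sum]
  simp only [map_smul, evalC0_apply, smul_eq_mul]
  by_cases h : ∃ k ∈ s, v k i ≠ 0
  · obtain ⟨k, hk, hki⟩ := h
    have hj : ∀ j ≠ k, v j i = 0 := fun j hjk =>
      of_not_not fun hji => disjoint_left.1 (hd hjk) hji hki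
    rw [Finset.sum_eq_single_of_mem k hk fun j _ hjk => by rw [hj j hjk, mul_zero], norm_mul]
    exact mul_le_one₀ (hθ k) (norm_nonneg _) ((norm_apply_le_norm_c0 _ i).trans (hv k))
  · push Not at h
    rw [Finset.sum_eq_zero fun k hk => by rw [h k hk, mul_zero], norm_zero]
    exact zero_le_one

theorem summable_norm_apply_of_disjoint (hv : ∀ k, ‖v k‖ ≤ 1)
    (hd : Pairwise fun j k => Disjoint (Function.support (v j)) (Function.support (v k)))
    (ℓ : C₀(ℕ, ℂ) →L[ℂ] ℂ) : Summable fun k => ‖ℓ (v k)‖ := by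
  choose θ hθ hθℓ using fun k => RCLike.exists_norm_eq_mul_self (ℓ (v k))
  refine summable_of_sum_le (c := ‖ℓ‖) (fun k => norm_nonneg _) fun s => ?_
  have hsum : ((∑ k ∈ s, ‖ℓ (v k)‖ : ℝ) : ℂ) = ℓ (∑ k ∈ s, θ k • v k) := by
    push_cast
    simp only [map_sum, map_smul, smul_eq_mul, ← hθℓ]
    rfl
  calc ∑ k ∈ s, ‖ℓ (v k)‖ ≤ ‖ℓ (∑ k ∈ s, θ k • v k)‖ := by
        rw [← hsum, Complex.norm_real]
        exact Real.le_norm_self _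
    _ ≤ ‖ℓ‖ := ℓ.unit_le_opNorm _ (norm_sum_smul_le_of_disjoint hv hd s fun k => (hθ k).le)

end DisjointSupports

section PolynomialsOnNullSequences

/-- The values of `P` on the closed unit ball of `c₀` are those of an element of `A(D̄^ℕ)`. -/
def ExtendsToPolydisc (P : C₀(ℕ, ℂ) → ℂ) : Prop :=
  ∃ g ∈ polydiscAlgebra, ∀ (x : C₀(ℕ, ℂ)) (z : ClosedPolydisc), (∀ i, (z i : ℂ) = x i) → g z = P x

variable {P : C₀(ℕ, ℂ) → ℂ}

theorem exists_polydiscAlgebra_eq_comp_headC0 (hP : Differentiable ℂ P) (N : ℕ) :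
    ∃ g ∈ polydiscAlgebra, ∀ z, g z = P (headC0 N fun i => z i) := by
  have hcont : Continuous fun z : ClosedPolydisc => P (headC0 N fun i => z i) :=
    hP.continuous.comp ((continuous_headC0 N).comp (by fun_prop))
  refine ⟨⟨_, hcont⟩, mem_polydiscAlgebra_iff.2 fun z i => ?_, fun _ => rfl⟩
  refine (hP.comp (differentiable_headC0_update N (fun j => z j) i)).differentiableOn.congr
    fun w hw => ?_
  rw [fixCoord_apply, toDisc_eq (ball_subset_closedBall hw)]
  refine congrArg (fun a => P (headC0 N a)) (funext fun j => ?_)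
  exact Function.apply_update (fun _ => Subtype.val) z i _ j

theorem extendsToPolydisc_of_forall_norm_sub_le (hP : Differentiable ℂ P)
    (h : ∀ ε > 0, ∃ N, ∀ M ≥ N, ∀ z : ClosedPolydisc,
      ‖P (headC0 M fun i => z i) - P (headC0 N fun i => z i)‖ ≤ ε) :
    ExtendsToPolydisc P := by
  choose g hg hgP using exists_polydiscAlgebra_eq_comp_headC0 hP
  have hcauchy : CauchySeq g := Metric.cauchySeq_iff'.2 fun ε hε => by
    obtain ⟨N, hN⟩ := h (ε / 2) (half_pos hε)
    refine ⟨N, fun M hM => lt_of_le_of_lt ?_ (half_lt_self hε)⟩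
    refine (ContinuousMap.dist_le (half_pos hε).le).2 fun z => ?_
    rw [dist_eq_norm, hgP, hgP]
    exact hN M hM z
  obtain ⟨G, hG⟩ := cauchySeq_tendsto_of_complete hcauchy
  refine ⟨G, isClosed_polydiscAlgebra.mem_of_tendsto hG (.of_forall hg), fun x z hz => ?_⟩
  refine tendsto_nhds_unique (((continuous_eval_const z).tendsto G).comp hG)
    (((hP.continuous.tendsto x).comp (tendsto_headC0 x)).congr fun N => ?_)
  simp only [Function.comp_apply, hgP, hz]

theorem exists_mem_segment_lt_norm_fderiv {E V : Type*} [NormedAddCommGroup E] [NormedSpace ℂ E]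
    [NormedAddCommGroup V] [NormedSpace ℂ V] {F : E → V} (hF : Differentiable ℂ F) {a b : E} {ε : ℝ}
    (h : ε < ‖F b - F a‖) : ∃ x ∈ segment ℝ a b, ε < ‖fderiv ℂ F x (b - a)‖ := by
  by_contra! hle
  have hderiv : ∀ t ∈ Icc (0 : ℝ) 1, HasDerivWithinAt (fun t : ℝ => F (AffineMap.lineMap a b t))
      (fderiv ℂ F (AffineMap.lineMap a b t) (b - a)) (Icc 0 1) t := fun t _ =>
    ((hF _).hasFDerivAt.restrictScalars ℝ).comp_hasDerivWithinAt t
      AffineMap.hasDerivWithinAt_lineMap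
  have hmvt := norm_image_sub_le_of_norm_deriv_le_segment_01' hderiv fun t ht =>
    hle _ (lineMap_mem_segment ℝ a b (Ico_subset_Icc_self ht))
  rw [AffineMap.lineMap_apply_one, AffineMap.lineMap_apply_zero] at hmvt
  exact absurd h (not_lt.2 hmvt)

theorem exists_lt_norm_fderiv_of_lt_norm_sub (hP : Differentiable ℂ P) {ε : ℝ} {N M : ℕ}
    {z : ℕ → ℂ} (hz : ∀ i, ‖z i‖ ≤ 1) (h : ε < ‖P (headC0 M z) - P (headC0 N z)‖) (hNM : N ≤ M) :
    ∃ x v : C₀(ℕ, ℂ), ‖x‖ ≤ 1 ∧ ‖v‖ ≤ 1 ∧ Function.support v ⊆ Ico N M ∧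
      ε < ‖fderiv ℂ P x v‖ := by
  obtain ⟨x, hx, hlt⟩ := exists_mem_segment_lt_norm_fderiv hP h
  have hball : ∀ n, headC0 n z ∈ closedBall (0 : C₀(ℕ, ℂ)) 1 := fun n =>
    mem_closedBall_zero_iff.2 (norm_headC0_le n zero_le_one hz)
  have hv : ∀ i, (headC0 M z - headC0 N z) i = if i ∈ Ico N M then z i else 0 := fun i => by
    rw [ZeroAtInftyContinuousMap.sub_apply, headC0_apply, headC0_apply]
    by_cases hi : i < N
    · simp [hi, hi.trans_le hNM]
    · simp [hi, not_lt.1 hi]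
  refine ⟨x, _, mem_closedBall_zero_iff.1
    ((convex_closedBall 0 1).segment_subset (hball N) (hball M) hx),
    norm_le_of_forall_c0 zero_le_one fun i => ?_, fun i hi => ?_, hlt⟩
  · rw [hv]
    split_ifs
    · exact hz i
    · exact norm_zero.trans_le zero_le_one
  · exact of_not_not fun hmem => hi ((hv i).trans (if_neg hmem))

theorem exists_disjoint_of_not_extendsToPolydisc (hP : Differentiable ℂ P)
    (h : ¬ ExtendsToPolydisc P) :
    ∃ ε > 0, ∃ x v : ℕ → C₀(ℕ, ℂ), (∀ k, ‖x k‖ ≤ 1) ∧ (∀ k, ‖v k‖ ≤ 1) ∧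
      (Pairwise fun j k => Disjoint (Function.support (v j)) (Function.support (v k))) ∧
      ∀ k, ε < ‖fderiv ℂ P (x k) (v k)‖ := by
  obtain ⟨ε, hε, htail⟩ : ∃ ε > 0, ∀ N, ∃ M ≥ N, ∃ z : ClosedPolydisc,
      ε < ‖P (headC0 M fun i => z i) - P (headC0 N fun i => z i)‖ := by
    by_contra! hsmall
    exact h (extendsToPolydisc_of_forall_norm_sub_le hP hsmall)
  choose M hM z hz using htail
  choose x v hx hv hsupp hlarge using fun N => exists_lt_norm_fderiv_of_lt_norm_sub hP
    (fun i => mem_closedBall_zero_iff.1 (z N i).2) (hz N) (hM N)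
  let ν : ℕ → ℕ := fun k => M^[k] 0
  have hν : ∀ k, ν (k + 1) = M (ν k) := fun k => Function.iterate_succ_apply' M k 0
  have hmono : Monotone ν := monotone_nat_of_le_succ fun k => (hM _).trans_eq (hν k).symm
  have hsub : ∀ k, Function.support (v (ν k)) ⊆ Ico (ν k) (ν (k + 1)) := fun k =>
    (hν k).symm ▸ hsupp (ν k)
  exact ⟨ε, hε, fun k => x (ν k), fun k => v (ν k), fun k => hx _, fun k => hv _,
    fun j k hjk => (hmono.pairwise_disjoint_on_Ico_succ hjk).mono (hsub j) (hsub k),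
    fun k => hlarge _⟩

namespace IsHomogeneousPolynomial

variable {m : ℕ} {v : ℕ → C₀(ℕ, ℂ)}

theorem subsum_fderiv (hP : IsHomogeneousPolynomial (m + 1) P) (hv : ∀ k, ‖v k‖ ≤ 1)
    (hd : Pairwise fun j k => Disjoint (Function.support (v j)) (Function.support (v k)))
    (S : ℕ → Bool) :
    IsHomogeneousPolynomial m fun x => subsum (fun k => fderiv ℂ P x (v k)) S := by
  let w : ℕ → C₀(ℕ, ℂ) := fun K => ∑ k ∈ Finset.range K, (if S k then 1 else 0 : ℂ) • v k
  have hw : ∀ K, ‖w K‖ ≤ 1 := fun K => norm_sum_smul_le_of_disjoint hv hd _ fun k => by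
    split_ifs <;> simp
  have hlim : ∀ x, Tendsto (fun K => fderiv ℂ P x (w K)) atTop
      (𝓝 (subsum (fun k => fderiv ℂ P x (v k)) S)) := fun x => by
    simp only [w, map_sum, _root_.map_smul, smul_eq_mul, ite_mul, one_mul, zero_mul]
    exact (summable_subsum
      (summable_norm_apply_of_disjoint hv hd (fderiv ℂ P x)) S).hasSum.tendsto_sum_nat
  refine ⟨fun x => ?_, fun c x => ?_⟩
  · obtain ⟨R, hR, C, hC⟩ := exists_norm_fderiv_le hP.differentiable x
    refine differentiableAt_of_tendsto_of_bounded (C := C) hR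
      (.of_forall fun K => (differentiable_fderiv_apply hP.differentiable (w K)).differentiableOn)
      (.of_forall fun K y hy => ?_) fun y _ => hlim y
    exact ((fderiv ℂ P y).unit_le_opNorm _ (hw K)).trans (hC y hy)
  · refine tendsto_nhds_unique (hlim _) ?_
    simp only [hP.fderiv_smul]
    exact (hlim x).const_smul (c ^ m)

/-- Along a subsequence on which `x k` converges in the polydisc, all the subsums of the rows
`j ↦ fderiv ℂ P (x k) (v j)` converge, as they extend continuously to the polydisc. -/
theorem exists_subseq_tendsto_fderiv_zero
    (hext : ∀ Q : C₀(ℕ, ℂ) → ℂ, IsHomogeneousPolynomial m Q → ExtendsToPolydisc Q)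
    (hP : IsHomogeneousPolynomial (m + 1) P) {x : ℕ → C₀(ℕ, ℂ)} (hx : ∀ k, ‖x k‖ ≤ 1)
    (hv : ∀ k, ‖v k‖ ≤ 1)
    (hd : Pairwise fun j k => Disjoint (Function.support (v j)) (Function.support (v k))) :
    ∃ φ : ℕ → ℕ, StrictMono φ ∧
      Tendsto (fun k => fderiv ℂ P (x (φ k)) (v (φ k))) atTop (𝓝 0) := by
  let ζ : ℕ → ClosedPolydisc := fun k i =>
    ⟨x k i, mem_closedBall_zero_iff.2 ((norm_apply_le_norm_c0 _ i).trans (hx k))⟩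
  obtain ⟨ζ', φ, hφ, hlim⟩ := CompactSpace.tendsto_subseq ζ
  have hdφ : Pairwise fun j k =>
      Disjoint (Function.support (v (φ j))) (Function.support (v (φ k))) :=
    hd.comp_of_injective hφ.injective
  refine ⟨φ, hφ, tendsto_diagonal_zero_of_cauchySeq_subsum
    (b := fun k j => fderiv ℂ P (x (φ k)) (v (φ j)))
    (fun k => summable_norm_apply_of_disjoint (fun j => hv (φ j)) hdφ _) fun S => ?_⟩
  obtain ⟨g, -, hgP⟩ := hext _ (hP.subsum_fderiv (fun j => hv (φ j)) hdφ S)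
  exact (((g.continuous.tendsto ζ').comp hlim).congr fun k =>
    hgP (x (φ k)) (ζ (φ k)) fun _ => rfl).cauchySeq

theorem extendsToPolydisc (hP : IsHomogeneousPolynomial m P) : ExtendsToPolydisc P := by
  induction m generalizing P with
  | zero =>
    refine ⟨algebraMap ℂ _ (P 0), polydiscAlgebra.algebraMap_mem _, fun x z _ => ?_⟩
    have hconst := hP.map_smul 0 x
    rwa [zero_smul, pow_zero, one_smul] at hconst
  | succ m ih =>
    by_contra hnot
    obtain ⟨ε, hε, x, v, hx, hv, hd, hlarge⟩ :=
      exists_disjoint_of_not_extendsToPolydisc hP.differentiable hnot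
    obtain ⟨φ, -, hφ⟩ := exists_subseq_tendsto_fderiv_zero (fun Q hQ => ih hQ) hP hx hv hd
    obtain ⟨k, hk⟩ := (hφ.norm.eventually_lt_const (norm_zero.trans_lt hε)).exists
    exact lt_asymm hk (hlarge (φ k))

end IsHomogeneousPolynomial

end PolynomialsOnNullSequences

section BallFunctions

theorem exists_forall_norm_smul_sub_le {E F : Type*} [NormedAddCommGroup E] [NormedSpace ℂ E]
    [NormedAddCommGroup F] {f : ball (0 : E) 1 → F} (hf : UniformContinuous f) {G : E → F}
    (hfG : ∀ x, f x = G x) {ε : ℝ} (hε : 0 < ε) :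
    ∃ r : ℂ, ‖r‖ < 1 ∧ ∀ x : ball (0 : E) 1, ‖G (r • x.1) - f x‖ ≤ ε := by
  obtain ⟨δ, hδ, hclose⟩ := Metric.uniformContinuous_iff.1 hf ε hε
  have hone : (1 : ℂ) ∈ closure (ball 0 1) := by simp [closure_ball (0 : ℂ) one_ne_zero]
  obtain ⟨r, hr, hrδ⟩ := Metric.mem_closure_iff.1 hone δ hδ
  rw [mem_ball_zero_iff] at hr
  refine ⟨r, hr, fun x => ?_⟩
  have hx := mem_ball_zero_iff.1 x.2
  have hrx : r • x.1 ∈ ball (0 : E) 1 := by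
    rw [mem_ball_zero_iff, norm_smul]
    exact mul_lt_one_of_nonneg_of_lt_one_left (norm_nonneg _) hr hx.le
  rw [← hfG ⟨_, hrx⟩, ← dist_eq_norm]
  refine (hclose (((Subtype.dist_eq _ _).trans (dist_eq_norm _ _)).trans_lt ?_)).le
  calc ‖r • x.1 - x.1‖ = dist 1 r * ‖x.1‖ := by
        rw [norm_sub_rev, dist_eq_norm, ← norm_smul, sub_smul, one_smul]
    _ ≤ dist 1 r := mul_le_of_le_one_right dist_nonneg hx.le
    _ < δ := hrδ

theorem exists_polydiscAlgebra_comp_ballPoint_eq {f : unitBallC0 → ℂ} (hf : f ∈ ballFunctions) :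
    ∃ g ∈ polydiscAlgebra, g ∘ ballPoint = f := by
  obtain ⟨huc, F, hF, hfF⟩ := hf
  obtain ⟨C, hC⟩ := isBounded_iff_forall_norm_le.1
    (isBounded_range_of_uniformContinuous (convex_ball 0 1) isBounded_ball huc)
  replace hC : ∀ y ∈ ball (0 : C₀(ℕ, ℂ)) 1, ‖F y‖ ≤ C := fun y hy =>
    hfF ⟨y, hy⟩ ▸ hC _ (mem_range_self _)
  choose G hG hGF using fun m =>
    (isHomogeneousPolynomial_homogeneousPart hF hC one_pos m).extendsToPolydisc
  refine exists_comp_eq_of_forall_approx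
    (fun g _ => norm_le_norm_pullback_of_denseRange denseRange_ballPoint g) huc.continuous
    fun ε hε => ?_
  obtain ⟨r, hr, hrf⟩ := exists_forall_norm_smul_sub_le huc hfF (half_pos hε)
  have htail : Tendsto (fun M : ℕ => C * ‖r‖ ^ M / (1 - ‖r‖)) atTop (𝓝 0) := by
    simpa using ((tendsto_pow_atTop_nhds_zero_of_lt_one (norm_nonneg r) hr).const_mul C).div_const
      (1 - ‖r‖)
  obtain ⟨M, hM⟩ := (htail.eventually_lt_const (half_pos hε)).exists
  refine ⟨∑ m ∈ Finset.range M, r ^ m • G m, Subalgebra.sum_mem _ fun m _ =>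
    Subalgebra.smul_mem _ (hG m) _, fun x => ?_⟩
  have hsum : (∑ m ∈ Finset.range M, r ^ m • G m) (ballPoint x) =
      ∑ m ∈ Finset.range M, r ^ m • homogeneousPart F m x.1 := by
    rw [ContinuousMap.sum_apply]
    exact Finset.sum_congr rfl fun m _ =>
      congrArg (r ^ m • ·) (hGF m x.1 (ballPoint x) fun _ => rfl)
  rw [hsum]
  calc ‖∑ m ∈ Finset.range M, r ^ m • homogeneousPart F m x.1 - f x‖
      ≤ ‖F (r • x.1) - ∑ m ∈ Finset.range M, r ^ m • homogeneousPart F m x.1‖ +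
        ‖F (r • x.1) - f x‖ := by
        rw [norm_sub_rev (F _) (∑ m ∈ _, _)]
        exact norm_sub_le_norm_sub_add_norm_sub _ _ _
    _ ≤ ε / 2 + ε / 2 := add_le_add ((norm_sub_sum_homogeneousPart_le hF hC one_pos
        (norm_lt_one_of_mem_unitBallC0 x.2).le hr M).trans hM.le) (hrf x)
    _ = ε := add_halves ε

end BallFunctions

theorem mainTheorem3 :
    -- `A(D̄^ℕ)` is a Banach algebra
    CompleteSpace polydiscAlgebra ∧
    -- `A(ℂ₊)` consists of bounded functions, is a Banach algebra with the supremum norm, and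
    -- is isometrically isomorphic to `A(D̄^ℕ)`
    (∃ A : Subalgebra ℂ (rightHalfPlane →ᵇ ℂ),
      (fun f : rightHalfPlane →ᵇ ℂ => (f : rightHalfPlane → ℂ)) '' (A : Set (rightHalfPlane →ᵇ ℂ))
        = dirichletFunctions ∧
      CompleteSpace A ∧
      ∃ e : polydiscAlgebra ≃ₐ[ℂ] A, Isometry e) ∧
    -- the same for `A_u(B_{c₀})`
    (∃ U : Subalgebra ℂ (unitBallC0 →ᵇ ℂ),
      (fun f : unitBallC0 →ᵇ ℂ => (f : unitBallC0 → ℂ)) '' (U : Set (unitBallC0 →ᵇ ℂ))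
        = ballFunctions ∧
      CompleteSpace U ∧
      ∃ e : polydiscAlgebra ≃ₐ[ℂ] U, Isometry e) := by
  refine ⟨inferInstance, ?_, ?_⟩
  · exact exists_algEquiv_of_norm_le_norm_pullback norm_le_norm_pullback_bohrPoint
      (fun _ => comp_bohrPoint_mem_dirichletFunctions)
      fun _ => exists_polydiscAlgebra_comp_bohrPoint_eq
  · exact exists_algEquiv_of_norm_le_norm_pullback
      (fun g _ => norm_le_norm_pullback_of_denseRange denseRange_ballPoint g)
      (fun _ => comp_ballPoint_mem_ballFunctions)
      fun _ => exists_polydiscAlgebra_comp_ballPoint_eq
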